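/- For $n>1$ let $\Delta_n=\{(p_1,\dots,p_n): p_k\ge 0,\ \sum_k p_k=1\}$ and let $q>0$ be fixed. Write $u\oplus_q v=u+v+(1-q)uv$, let $p_k^{(q)}=p_k^q/\sum_{i} p_i^q$ be the $q$-escort probabilities of $P\in\Delta_n$, and let $U_n=(1/n,\dots,1/n)$. Let $\mathcal D_n:\Delta_n\to\mathbb R$ ($n>1$) be a family of functions, let $J=\bigcup_{n>1}\mathcal D_n(\Delta_n)$ be the set of its values, and let $f_h$ be a real function. We say that $(\mathcal D_n)$ satisfies the generalized Shannon–Khinchin axioms [A1]–[A4] with generator $f_h$ if $\mathcal D_n\ge 0$ for all $n>1$ and - [A1] each $\mathcal D_n$, $n>1$, is continuous on $\Delta_n$; - [A2] $\mathcal D_n(P)\le\mathcal D_n(U_n)$ for all $n>1$ and $P\in\Delta_n$; - [A3] $\mathcal D_{n+1}(p_1,\dots,p_n,0)=\mathcal D_n(p_1,\dots,p_n)$ for all $n>1$ and $(p_1,\dots,p_n)\in\Delta_n$; - [A4] $f_h$ is continuous and injective on $J$, and for all $n,m>1$ and all $PQ=(r_{11},r_{12},\dots,r_{nm})\in\Delta_{nm}$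 with $P=(p_1,\dots,p_n)$, $p_i=\sum_{j=1}^m r_{ij}$, and $Q_{|i}=(r_{i1}/p_i,\dots,r_{im}/p_i)\in\Delta_m$ (an arbitrary element of $\Delta_m$ if $p_i=0$), $$\mathcal D_{nm}(PQ)=\mathcal D_n(P)\oplus_q \mathcal D_m(Q|P),\qquad \mathcal D_m(Q|P)=f_h^{-1}\Big(\sum_{i=1}^n p_i^{(q)} f_h(\mathcal D_m(Q_{|i}))\Big),$$ where $f_h^{-1}$ is the inverse of $f_h|_J$. Then: 1. The functions $\mathcal D_n$ are not all constant and satisfy [A1]–[A4] with some generator $f_h$ if and only if there is $\tau<0$ such that, for all $n>1$ and $P\in\Delta_n$, $$\mathcal D_n(P)=\begin{cases}\tau\sum_{k=1}^n p_k\log_2 p_k, & q=1,\\[2pt] \dfrac{1}{1-q}\Big(\big(\sum_{k=1}^n p_k^q\big)^{-\tau}-1\Big), & q\neq 1,\end{cases}$$ where $0\log_2 0=0$. 2. If $\mathcal D_n$ has this form for some $\tau<0$, then $(\mathcal D_n)$ satisfies [A1]–[A4] with generator $f_h$ if and only if there are real $a\neq 0$ and $b$ such that $f_h(x)=a\,f_\tau(x)+b$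 for all $x\in J$, where $f_\tau(x)=\tau x$ if $q=1$ and $f_\tau(x)=((1-q)x+1)^{-1/\tau}$ if $q\neq 1$. -/

import Mathlib

noncomputable section

namespace GSK

/-- `Δ n` is the set of all `n`-dimensional probability distributions. -/
abbrev Δ (n : ℕ) : Type := stdSimplex ℝ (Fin n)

/-- The uniform distribution `U_n`. -/
def uniform (n : ℕ) (hn : 2 ≤ n) : Δ n :=
  ⟨fun _ => 1 / (n : ℝ), fun _ => by positivity, by
    have : (n : ℝ) ≠ 0 := by
      have : n ≠ 0 := by omega
      exact_mod_cast this
    simp [this]⟩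

/-- `(p₁, …, pₙ) ↦ (p₁, …, pₙ, 0)`. -/
def expand {n : ℕ} (P : Δ n) : Δ (n + 1) :=
  ⟨Fin.snoc (α := fun _ => ℝ) P.1 0, by
    refine ⟨fun i => ?_, ?_⟩
    · refine Fin.lastCases ?_ (fun j => ?_) i
      · simp
      · simpa using P.2.1 j
    · rw [Fin.sum_univ_castSucc]
      simpa using P.2.2⟩

/-- The `q`-escort distribution: `p_k ^ q / ∑ i, p_i ^ q`. -/
def escort (q : ℝ) {n : ℕ} (P : Δ n) (k : Fin n) : ℝ :=
  P.1 k ^ q / ∑ i, P.1 i ^ q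

/-- `u ⊕_q v = u + v + (1 - q) u v`. -/
def qAdd (q u v : ℝ) : ℝ := u + v + (1 - q) * u * v

/-- The set of all values taken by the functions `D n`, `n > 1`. -/
def values (D : (n : ℕ) → Δ n → ℝ) : Set ℝ :=
  {x | ∃ n : ℕ, 2 ≤ n ∧ ∃ P : Δ n, D n P = x}

/-- The conditional entropy `D_m(Q|P) = f⁻¹ (∑ i, p_i^{(q)} f (D_m(Q_{|i})))`, where `f⁻¹` is the
inverse of the restriction of `f` to the set of values of the entropy. -/
def condEntropy (q : ℝ) (D : (n : ℕ) → Δ n → ℝ) (f : ℝ → ℝ) {n m : ℕ}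
    (P : Δ n) (Q : Fin n → Δ m) : ℝ :=
  Function.invFunOn f (values D) (∑ i, escort q P i * f (D m (Q i)))

/-- The generalized Shannon–Khinchin axioms for a family `D n : Δ n → [0, ∞)`, `n > 1`, with
parameter `q` and generator `f`. The functions `D 0` and `D 1` play no role. -/
structure Axioms (q : ℝ) (D : (n : ℕ) → Δ n → ℝ) (f : ℝ → ℝ) : Prop where
  /-- The functions take values in `[0, ∞)`. -/
  nonneg : ∀ n, 2 ≤ n → ∀ P : Δ n, 0 ≤ D n P
  /-- Continuity. -/
  continuous : ∀ n, 2 ≤ n → Continuous (D n)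
  /-- Maximality at the uniform distribution. -/
  maximal : ∀ n, ∀ hn : 2 ≤ n, ∀ P : Δ n, D n P ≤ D n (uniform n hn)
  /-- Expandability. -/
  expandable : ∀ n, 2 ≤ n → ∀ P : Δ n, D (n + 1) (expand P) = D n P
  /-- The generator is continuous on the values of the entropy. -/
  gen_continuous : ContinuousOn f (values D)
  /-- The generator is invertible on the values of the entropy. -/
  gen_invertible : Set.InjOn f (values D)
  /-- `q`-additivity. `R` lists the joint probabilities `r_{ij}` in the order
  `r₁₁, r₁₂, …, r_{nm}`, `P` is its marginal and `Q i` is the conditional distribution `Q_{|i}`.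
  If `p_i = 0`, then `Q_{|i}` can be any distribution; its weight is zero. -/
  additive : ∀ n m, 2 ≤ n → 2 ≤ m → ∀ (R : Δ (n * m)) (P : Δ n) (Q : Fin n → Δ m),
    (∀ i, P.1 i = ∑ j, R.1 (finProdFinEquiv (i, j))) →
    (∀ i, P.1 i ≠ 0 → ∀ j, (Q i).1 j = R.1 (finProdFinEquiv (i, j)) / P.1 i) →
    D (n * m) R = qAdd q (D n P) (condEntropy q D f P Q)

/-- At least one of the functions `D n`, `n > 1`, is not constant. -/
def Nonconstant (D : (n : ℕ) → Δ n → ℝ) : Prop :=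
  ∃ n : ℕ, 2 ≤ n ∧ ∃ P P' : Δ n, D n P ≠ D n P'

/-- The entropy with parameters `q` and `τ`. -/
def entropy (q τ : ℝ) {n : ℕ} (P : Δ n) : ℝ :=
  if q = 1 then τ * ∑ k, P.1 k * Real.logb 2 (P.1 k)
  else 1 / (1 - q) * ((∑ k, P.1 k ^ q) ^ (-τ) - 1)

/-- The generator with parameters `q` and `τ`. -/
def generator (q τ x : ℝ) : ℝ :=
  if q = 1 then τ * x else ((1 - q) * x + 1) ^ (-1 / τ)

end GSK

end

/-! By [A3] the family is one function `D` of finitely supported sequences. If `D` is not constant,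
it vanishes on point masses and its values satisfy `1 + (1 - q) x > 0` (`one_add_pos`). The
`q`-logarithm then turns `⊕_q` into addition (`qLog_comp`). The result is an entropy `H` with value
set `[0, ∞)` and generator `F = f ∘ qExp q`, still with `q`-escort weights.

Independence makes `H (unif n)` proportional to `log n`. Appending an independent distribution shows
that the quasi-arithmetic means of `F` commute with translations (`translate`), so `F` is affine or
`a exp (l x) + b` (`generator_of_translate`). Splitting the uniform distribution on five points in
two ways (`five_relations`) shows that the affine case needs `q = 1`, and that `l` is fixed by `q`
and `H (unif 2)` in the exponential case. Hence `f` is an affine function of the stated generator,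
with `τ` chosen to match the value at `U_2`.

The explicit entropy with this `τ` satisfies the axioms with the same `f` (`axioms_of_entropy`). An
additive entropy is determined by its generator and its value at `U_2` (`unique`), so it equals `D`.
This also gives the second claim, as `τ` can be read off from the value at `U_2`. Symmetry is not an
axiom, so permutations of the probabilities are never used. -/

open Finset

namespace GSK

/-! ### Finitely supported distributions and their joint distributions -/

/-- `p` is a probability distribution on `ℕ` supported in `{0, …, n - 1}`. -/
structure Dist (n : ℕ) (p : ℕ → ℝ) : Prop where
  nonneg : ∀ i, 0 ≤ p i
  zero : ∀ i, n ≤ i → p i = 0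
  sum : ∑ i ∈ range n, p i = 1

/-- The joint distribution with marginal `P` and conditional distributions `Q i`, listed in
consecutive blocks of length `m`. -/
noncomputable def joint (m : ℕ) (P : ℕ → ℝ) (Q : ℕ → ℕ → ℝ) (k : ℕ) : ℝ :=
  P (k / m) * Q (k / m) (k % m)

/-- The uniform distribution on `{0, …, n - 1}`. -/
noncomputable def unif (n : ℕ) (i : ℕ) : ℝ := if i < n then 1 / (n : ℝ) else 0

/-- The distribution `(p, 1 - p, 0, 0, …)`. -/
noncomputable def binary (p : ℝ) (i : ℕ) : ℝ := if i = 0 then p else if i = 1 then 1 - p else 0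

/-- The joint distribution with marginal `(p, 1 - p)` and conditional distributions `A`, `B`. -/
noncomputable def mix (m : ℕ) (p : ℝ) (A B : ℕ → ℝ) (k : ℕ) : ℝ :=
  if k < m then p * A k else (1 - p) * B (k - m)

lemma Dist.succ {n : ℕ} {p : ℕ → ℝ} (h : Dist n p) : Dist (n + 1) p :=
  ⟨h.nonneg, fun i hi => h.zero i (by omega), by
    rw [sum_range_succ, h.sum, h.zero n le_rfl, add_zero]⟩

lemma Dist.mono {n n' : ℕ} {p : ℕ → ℝ} (h : Dist n p) (hn : n ≤ n') : Dist n' p := by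
  induction n', hn using Nat.le_induction with
  | base => exact h
  | succ k _ ih => exact ih.succ

lemma dist_unif {n : ℕ} (hn : 1 ≤ n) : Dist n (unif n) := by
  refine ⟨fun i => ?_, fun i hi => ?_, ?_⟩
  · unfold unif; split_ifs <;> positivity
  · simp [unif, hi]
  · have h0 : (n : ℝ) ≠ 0 := by positivity
    have : ∑ i ∈ range n, unif n i = ∑ i ∈ range n, 1 / (n : ℝ) :=
      sum_congr rfl fun i hi => by simp [unif, mem_range.1 hi]
    rw [this]; simp [h0]

lemma dist_binary {p : ℝ} (h0 : 0 ≤ p) (h1 : p ≤ 1) : Dist 2 (binary p) := by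
  refine ⟨fun i => ?_, fun i hi => ?_, ?_⟩
  · unfold binary; split_ifs <;> linarith
  · simp [binary, show i ≠ 0 by omega, show i ≠ 1 by omega]
  · simp [sum_range_succ, binary]

lemma sum_range_mul_eq (f : ℕ → ℝ) (n m : ℕ) :
    ∑ k ∈ range (n * m), f k = ∑ i ∈ range n, ∑ j ∈ range m, f (i * m + j) := by
  induction n with
  | zero => simp
  | succ n ih => rw [Nat.succ_mul, sum_range_add, ih, sum_range_succ]

lemma joint_apply {m : ℕ} (P : ℕ → ℝ) (Q : ℕ → ℕ → ℝ) (i : ℕ) {j : ℕ} (hj : j < m) :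
    joint m P Q (i * m + j) = P i * Q i j := by
  have h1 : (i * m + j) / m = i := by
    rw [mul_comm, Nat.mul_add_div (by omega), Nat.div_eq_of_lt hj, add_zero]
  have h2 : (i * m + j) % m = j := by
    rw [mul_comm, Nat.mul_add_mod, Nat.mod_eq_of_lt hj]
  simp [joint, h1, h2]

lemma dist_joint {n m : ℕ} {P : ℕ → ℝ} {Q : ℕ → ℕ → ℝ} (hm : 0 < m) (hP : Dist n P)
    (hQ : ∀ i < n, Dist m (Q i)) : Dist (n * m) (joint m P Q) := by
  have key : ∀ i, n ≤ i / m → joint m P Q i = 0 := fun i hi => by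
    simp [joint, hP.zero _ hi]
  refine ⟨fun i => ?_, fun i hi => key i ((Nat.le_div_iff_mul_le hm).2 hi), ?_⟩
  · rcases lt_or_ge (i / m) n with h | h
    · exact mul_nonneg (hP.nonneg _) ((hQ _ h).nonneg _)
    · rw [key i h]
  · rw [sum_range_mul_eq, ← hP.sum]
    refine sum_congr rfl fun i hi => ?_
    rw [sum_congr rfl fun j hj => joint_apply P Q i (mem_range.1 hj), ← mul_sum,
      (hQ i (mem_range.1 hi)).sum, mul_one]

lemma joint_binary {m : ℕ} (hm : 0 < m) (p : ℝ) (A : ℕ → ℝ) {B : ℕ → ℝ} (hB : Dist m B) :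
    joint m (binary p) (fun i => if i = 0 then A else B) = mix m p A B := by
  funext k
  rcases lt_or_ge k m with h | h
  · simp [joint, mix, h, Nat.div_eq_of_lt h, Nat.mod_eq_of_lt h, binary]
  · have h0 : k / m ≠ 0 := by
      have := (Nat.le_div_iff_mul_le hm).2 (by simpa using h : 1 * m ≤ k)
      omega
    rcases lt_or_ge k (2 * m) with h2 | h2
    · have h1 : k / m = 1 :=
        le_antisymm (Nat.lt_succ_iff.1 ((Nat.div_lt_iff_lt_mul hm).2 h2))
          (Nat.one_le_iff_ne_zero.2 h0)
      have h3 : k % m = k - m := by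
        rw [Nat.mod_eq_sub_mod h, Nat.mod_eq_of_lt (by omega)]
      simp [joint, mix, h1, h3, binary, h.not_gt]
    · have h1 : 2 ≤ k / m := (Nat.le_div_iff_mul_le hm).2 h2
      simp [joint, mix, h.not_gt, binary, h0, show k / m ≠ 1 by omega, hB.zero (k - m) (by omega)]

lemma dist_mix {m : ℕ} {p : ℝ} {A B : ℕ → ℝ} (hm : 0 < m) (h0 : 0 ≤ p) (h1 : p ≤ 1)
    (hA : Dist m A) (hB : Dist m B) : Dist (2 * m) (mix m p A B) := by
  rw [← joint_binary hm p A hB]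
  refine dist_joint hm (dist_binary h0 h1) fun i _ => ?_
  by_cases hi : i = 0 <;> simp [hi, hA, hB]

lemma dist_segment {n : ℕ} {p p' : ℕ → ℝ} (h : Dist n p) (h' : Dist n p') {t : ℝ}
    (h0 : 0 ≤ t) (h1 : t ≤ 1) : Dist n (fun i => (1 - t) * p i + t * p' i) := by
  refine ⟨fun i => ?_, fun i hi => by simp [h.zero i hi, h'.zero i hi], ?_⟩
  · exact add_nonneg (mul_nonneg (by linarith) (h.nonneg i)) (mul_nonneg h0 (h'.nonneg i))
  · rw [sum_add_distrib, ← mul_sum, ← mul_sum, h.sum, h'.sum]; ring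

lemma binary_one : binary 1 = unif 1 := by
  funext i; by_cases hi : i = 0 <;> simp [binary, unif, hi]

lemma binary_half : binary (1 / 2) = unif 2 := by
  funext i
  rcases i with _ | _ | i
  · simp [binary, unif]
  · simp [binary, unif]; norm_num
  · simp [binary, unif]

lemma Dist.sum_rpow_pos {q : ℝ} {n : ℕ} {P : ℕ → ℝ} (h : Dist n P) :
    0 < ∑ j ∈ range n, P j ^ q := by
  have hn : ∀ j ∈ range n, 0 ≤ P j ^ q := fun j _ => Real.rpow_nonneg (h.nonneg j) q
  obtain ⟨j, hj, hpos⟩ : ∃ j ∈ range n, 0 < P j := by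
    by_contra! hc
    have := sum_nonpos hc
    rw [h.sum] at this; linarith
  exact lt_of_lt_of_le (Real.rpow_pos_of_pos hpos q) (single_le_sum hn hj)

/-! ### From a family on simplices to one function of sequences -/

/-- The values of `D` on finitely supported distributions. -/
def seqValues (D : (ℕ → ℝ) → ℝ) : Set ℝ := {x | ∃ n p, Dist n p ∧ D p = x}

/-- The generalized Shannon–Khinchin axioms for a function of finitely supported distributions,
with parameter `r` of the addition and parameter `q` of the escort distribution. -/
structure SeqAxioms (r q : ℝ) (D : (ℕ → ℝ) → ℝ) (f : ℝ → ℝ) : Prop where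
  nonneg : ∀ n p, Dist n p → 0 ≤ D p
  continuousOn : ∀ n p p', Dist n p → Dist n p' →
    ContinuousOn (fun t : ℝ => D fun i => (1 - t) * p i + t * p' i) (Set.Icc 0 1)
  maximal : ∀ n p, 2 ≤ n → Dist n p → D p ≤ D (unif n)
  gen_continuous : ContinuousOn f (seqValues D)
  gen_invertible : Set.InjOn f (seqValues D)
  chain : ∀ n m, 2 ≤ n → 2 ≤ m → ∀ P Q, Dist n P → (∀ i < n, Dist m (Q i)) →
    ∃ y ∈ seqValues D, f y = ∑ i ∈ range n, P i ^ q / (∑ j ∈ range n, P j ^ q) * f (D (Q i)) ∧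
      D (joint m P Q) = qAdd r (D P) y

/-- The element of the simplex given by the first `n` terms of a sequence. -/
def restrict {n : ℕ} {p : ℕ → ℝ} (h : Dist n p) : Δ n :=
  ⟨fun i => p i, fun i => h.nonneg i, by rw [← h.sum, sum_range]⟩

/-- The extension of an element of the simplex by zeros. -/
noncomputable def extend {n : ℕ} (P : Δ n) (i : ℕ) : ℝ := if h : i < n then P.1 ⟨i, h⟩ else 0

lemma dist_extend {n : ℕ} (P : Δ n) : Dist n (extend P) := by
  refine ⟨fun i => ?_, fun i hi => by simp [extend, hi], ?_⟩
  · unfold extend; split_ifs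
    · exact P.2.1 _
    · exact le_rfl
  · rw [sum_range, ← P.2.2]
    exact sum_congr rfl fun i _ => by simp [extend]

lemma restrict_extend {n : ℕ} (P : Δ n) : restrict (dist_extend P) = P := by
  apply Subtype.ext; funext i; simp [restrict, extend]

lemma restrict_unif {n : ℕ} (hn : 2 ≤ n) :
    restrict (dist_unif (one_le_two.trans hn)) = uniform n hn := by
  apply Subtype.ext; funext i
  simp [restrict, uniform, unif]

open Classical in
/-- The function of finitely supported distributions given by an expandable family. -/
noncomputable def seqOf (D : (n : ℕ) → Δ n → ℝ) (p : ℕ → ℝ) : ℝ :=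
  if h : ∃ n, 2 ≤ n ∧ Dist n p then D _ (restrict h.choose_spec.2) else 0

section Extension

variable {q : ℝ} {D : (n : ℕ) → Δ n → ℝ} {f : ℝ → ℝ}

lemma expand_restrict {n : ℕ} {p : ℕ → ℝ} (h : Dist n p) :
    expand (restrict h) = restrict h.succ := by
  apply Subtype.ext; funext i
  refine Fin.lastCases ?_ (fun j => ?_) i
  · simp [expand, restrict, h.zero n le_rfl]
  · simp [expand, restrict]

lemma restrict_eq_of_le (hD : ∀ n, 2 ≤ n → ∀ P : Δ n, D (n + 1) (expand P) = D n P)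
    {n n' : ℕ} {p : ℕ → ℝ} (hn : 2 ≤ n) (hnn : n ≤ n') (h : Dist n p) :
    D n' (restrict (h.mono hnn)) = D n (restrict h) := by
  induction n', hnn using Nat.le_induction with
  | base => rfl
  | succ k hk ih => rw [← ih, ← hD k (by omega), expand_restrict]

/-- Two admissible lengths are compared through their maximum, so the length chosen in `seqOf` does
not matter. -/
lemma seqOf_eq (hD : ∀ n, 2 ≤ n → ∀ P : Δ n, D (n + 1) (expand P) = D n P)
    {n : ℕ} {p : ℕ → ℝ} (hn : 2 ≤ n) (h : Dist n p) : seqOf D p = D n (restrict h) := by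
  have hex : ∃ n, 2 ≤ n ∧ Dist n p := ⟨n, hn, h⟩
  rw [seqOf, dif_pos hex,
    ← restrict_eq_of_le hD hex.choose_spec.1 (le_max_left _ n) hex.choose_spec.2,
    ← restrict_eq_of_le hD hn (le_max_right hex.choose n) h]

lemma seqOf_extend (hD : ∀ n, 2 ≤ n → ∀ P : Δ n, D (n + 1) (expand P) = D n P)
    {n : ℕ} (hn : 2 ≤ n) (P : Δ n) : seqOf D (extend P) = D n P := by
  rw [seqOf_eq hD hn (dist_extend P), restrict_extend]

lemma seqValues_seqOf (hD : ∀ n, 2 ≤ n → ∀ P : Δ n, D (n + 1) (expand P) = D n P) :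
    seqValues (seqOf D) = values D := by
  ext x
  constructor
  · rintro ⟨n, p, hp, rfl⟩
    -- `Dist n` allows `n < 2`; padding with zeros reaches a length covered by the axioms.
    exact ⟨n + 2, by omega, _, (seqOf_eq hD (by omega) (hp.mono (by omega))).symm⟩
  · rintro ⟨n, hn, P, rfl⟩
    exact ⟨n, extend P, dist_extend P, seqOf_extend hD hn P⟩

/-- Each simplex has a connected image, and all these images share the value at the point mass. -/
lemma isPreconnected_values (hD : ∀ n, 2 ≤ n → ∀ P : Δ n, D (n + 1) (expand P) = D n P)
    (hc : ∀ n, 2 ≤ n → Continuous (D n)) : IsPreconnected (values D) := by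
  refine isPreconnected_of_forall (seqOf D (unif 1)) ?_
  rintro _ ⟨n, hn, P, rfl⟩
  refine ⟨Set.range (D n), ?_, ?_, ⟨P, rfl⟩, ?_⟩
  · rintro _ ⟨P', rfl⟩; exact ⟨n, hn, P', rfl⟩
  · exact ⟨_, (seqOf_eq hD hn ((dist_unif le_rfl).mono (by omega))).symm⟩
  · have : PreconnectedSpace (Δ n) :=
      isPreconnected_iff_preconnectedSpace.1 (convex_stdSimplex ℝ (Fin n)).isPreconnected
    exact isPreconnected_range (hc n hn)

lemma sum_rpow_pos {n : ℕ} (P : Δ n) : 0 < ∑ i, P.1 i ^ q := by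
  have := (dist_extend P).sum_rpow_pos (q := q)
  rw [sum_range] at this
  simpa [extend] using this

lemma sum_escort {n : ℕ} (P : Δ n) : ∑ i, escort q P i = 1 := by
  simp only [escort]
  rw [← sum_div, div_self (sum_rpow_pos P).ne']

/-- The image of `f` on the values is an interval, so it contains every escort mean and `invFunOn`
is a genuine inverse there. -/
lemma condEntropy_spec (hD : ∀ n, 2 ≤ n → ∀ P : Δ n, D (n + 1) (expand P) = D n P)
    (hc : ∀ n, 2 ≤ n → Continuous (D n)) (hf : ContinuousOn f (values D)) {n m : ℕ}
    (hm : 2 ≤ m) (P : Δ n) (Q : Fin n → Δ m) :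
    condEntropy q D f P Q ∈ values D ∧
      f (condEntropy q D f P Q) = ∑ i, escort q P i * f (D m (Q i)) := by
  have hconv : Convex ℝ (f '' values D) :=
    ((isPreconnected_values hD hc).image f hf).ordConnected.convex
  have hmem : ∑ i, escort q P i * f (D m (Q i)) ∈ f '' values D := by
    have := hconv.sum_mem (t := univ) (w := escort q P) (z := fun i => f (D m (Q i)))
      (fun i _ => div_nonneg (Real.rpow_nonneg (P.2.1 i) q) (sum_rpow_pos P).le)
      (sum_escort P) (fun i _ => ⟨_, ⟨m, hm, Q i, rfl⟩, rfl⟩)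
    simpa using this
  exact ⟨Function.invFunOn_mem hmem, Function.invFunOn_eq hmem⟩

/-- The inverse of `f` is replaced by a value `y` with prescribed `f y`. The two parameters start
equal; the `q`-logarithm later turns the first into `1`. -/
theorem Axioms.seqAxioms (h : Axioms q D f) : SeqAxioms q q (seqOf D) f := by
  have hD := h.expandable
  have hv := seqValues_seqOf hD
  refine ⟨fun n p hp => ?_, fun n p p' hp hp' => ?_, fun n p hn hp => ?_, ?_, ?_, ?_⟩
  · rw [seqOf_eq hD (by omega) (hp.mono (by omega : n ≤ n + 2))]
    exact h.nonneg _ (by omega) _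
  · have hp2 := hp.mono (by omega : n ≤ n + 2)
    have hp2' := hp'.mono (by omega : n ≤ n + 2)
    rw [continuousOn_iff_continuous_domRestrict]
    have : ((Set.Icc (0 : ℝ) 1).domRestrict
        fun t : ℝ => seqOf D fun i => (1 - t) * p i + t * p' i) =
        fun t : Set.Icc (0 : ℝ) 1 =>
          D (n + 2) (restrict (dist_segment hp2 hp2' t.2.1 t.2.2)) := by
      funext t
      exact seqOf_eq hD (by omega) (dist_segment hp2 hp2' t.2.1 t.2.2)
    rw [this]
    refine (h.continuous (n + 2) (by omega)).comp (Continuous.subtype_mk ?_ _)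
    fun_prop
  · rw [seqOf_eq hD hn hp, seqOf_eq hD hn (dist_unif (by omega))]
    rw [restrict_unif hn]
    exact h.maximal n hn (restrict hp)
  · rw [hv]; exact h.gen_continuous
  · rw [hv]; exact h.gen_invertible
  · intro n m hn hm P Q hP hQ
    have hR := dist_joint (by omega) hP hQ
    have hnm : 2 ≤ n * m := by nlinarith
    obtain ⟨h1, h2⟩ := condEntropy_spec (q := q) hD h.continuous h.gen_continuous hm (restrict hP)
      (fun i => restrict (hQ i i.2))
    have hval : ∀ (i : Fin n) (j : Fin m), (restrict hR).1 (finProdFinEquiv (i, j)) =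
        P i * Q i j := fun i j => by
      simp only [restrict, finProdFinEquiv_apply_val]
      rw [add_comm, mul_comm m]
      exact joint_apply P Q i j.2
    refine ⟨_, hv ▸ h1, ?_, ?_⟩
    · rw [h2, sum_range]
      refine sum_congr rfl fun i _ => ?_
      rw [seqOf_eq hD hm (hQ i i.2), escort, sum_range]
      rfl
    · rw [seqOf_eq hD hnm hR, seqOf_eq hD hn hP]
      refine h.additive n m hn hm _ _ _ (fun i => ?_) (fun i hi j => ?_)
      · simp only [hval]
        rw [← mul_sum, ← sum_range, (hQ i i.2).sum, mul_one]; rfl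
      · rw [hval, eq_div_iff hi, mul_comm]; rfl

end Extension

/-! ### Identities between joint distributions -/

lemma joint_point {m : ℕ} {p : ℕ → ℝ} (hp : Dist m p) :
    joint m (unif 1) (fun _ => p) = p := by
  funext k
  rcases lt_or_ge k m with h | h
  · simp [joint, unif, Nat.div_eq_of_lt h, Nat.mod_eq_of_lt h]
  · rcases Nat.eq_zero_or_pos m with rfl | hm
    · simpa using hp.sum
    · have : ¬ k / m < 1 := not_lt.2 ((Nat.le_div_iff_mul_le hm).2 (by simpa using h))
      simp only [joint, unif, this, if_false, zero_mul, hp.zero k h]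

lemma joint_unif {n m : ℕ} (hm : 0 < m) :
    joint m (unif n) (fun _ => unif m) = unif (n * m) := by
  funext k
  have h1 : k / m < n ↔ k < n * m := Nat.div_lt_iff_lt_mul hm
  simp only [joint, unif, h1, Nat.mod_lt k hm, if_true]
  split_ifs <;> simp [mul_comm]

/-- Associativity of refinement: an independent factor can be moved inside the conditional
distributions. -/
lemma joint_joint {m k : ℕ} (P : ℕ → ℝ) (Q : ℕ → ℕ → ℝ) (T : ℕ → ℝ) :
    joint k (joint m P Q) (fun _ => T) =
      joint (m * k) P (fun i => joint k (Q i) fun _ => T) := by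
  funext i
  simp only [joint]
  rw [Nat.div_div_eq_div_mul, mul_comm k m, Nat.mod_mul_left_mod, mul_assoc,
    Nat.mod_mul_left_div_self]

lemma mix_unif {m r : ℕ} (hm : 0 < m) (hr : 0 < r) :
    mix m (m / (m + r)) (unif m) (unif r) = unif (m + r) := by
  funext k
  have hm' : (m : ℝ) ≠ 0 := by positivity
  have hr' : (r : ℝ) ≠ 0 := by positivity
  have hmr : (m : ℝ) + r ≠ 0 := by positivity
  simp only [mix, unif]
  rcases lt_or_ge k m with h | h
  · simp only [h, show k < m + r by omega, if_true]
    push_cast; field_simp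
  · simp only [h.not_gt, if_false]
    by_cases h2 : k < m + r
    · simp only [h2, show k - m < r by omega, if_true]
      push_cast; field_simp; ring
    · simp [h2, show ¬ k - m < r by omega]

/-- The distribution `(p, 0, (1 - p) s, (1 - p) (1 - s))`, grouped in two ways. -/
lemma mix_regroup {p s : ℝ} (hps : 0 < p + (1 - p) * s) :
    mix 2 p (unif 1) (binary s) = mix 3 (p + (1 - p) * s)
      (mix 2 (p / (p + (1 - p) * s)) (unif 1) (unif 1)) (unif 1) := by
  funext k
  rcases k with _ | _ | _ | _ | k
  · simp [mix, unif]; field_simp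
  · simp [mix, unif]
  · simp [mix, unif, binary]; field_simp; ring
  · simp [mix, unif, binary]; ring
  · simp [mix, unif, binary]

/-- The second block is a point mass, so the fourth cell is empty. Three cells are what
`mix_regroup` needs for its outer blocks. -/
lemma dist_mix_point {p : ℝ} (h0 : 0 ≤ p) (h1 : p ≤ 1) : Dist 3 (mix 2 p (unif 1) (unif 1)) := by
  have hδ := (dist_unif le_rfl).mono one_le_two
  have h : Dist 4 (mix 2 p (unif 1) (unif 1)) := dist_mix two_pos h0 h1 hδ hδ
  refine ⟨h.nonneg, fun i hi => ?_, ?_⟩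
  · rcases hi.eq_or_lt with rfl | hi
    · simp [mix, unif]
    · exact h.zero i hi
  · have := h.sum
    rw [sum_range_succ] at this
    simpa [mix, unif] using this

/-! ### First consequences of the chain rule; the absorbing value is not attained -/

namespace SeqAxioms

variable {r q : ℝ} {D : (ℕ → ℝ) → ℝ} {f : ℝ → ℝ}

lemma mem_values {n : ℕ} {p : ℕ → ℝ} (hp : Dist n p) : D p ∈ seqValues D := ⟨n, p, hp, rfl⟩

/-- The chain rule for a marginal distribution on two points. -/
lemma chain_mix (h : SeqAxioms r q D f) {m : ℕ} (hm : 2 ≤ m) {p : ℝ} (h0 : 0 ≤ p) (h1 : p ≤ 1)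
    {A B : ℕ → ℝ} (hA : Dist m A) (hB : Dist m B) :
    ∃ y ∈ seqValues D, f y = p ^ q / (p ^ q + (1 - p) ^ q) * f (D A) +
      (1 - p) ^ q / (p ^ q + (1 - p) ^ q) * f (D B) ∧
      D (mix m p A B) = qAdd r (D (binary p)) y := by
  obtain ⟨y, hy, h2, h3⟩ := h.chain 2 m le_rfl hm (binary p) (fun i => if i = 0 then A else B)
    (dist_binary h0 h1) (fun i _ => by by_cases hi : i = 0 <;> simp [hi, hA, hB])
  refine ⟨y, hy, ?_, ?_⟩
  · simpa [sum_range_succ, binary] using h2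
  · rwa [joint_binary (by omega) p A hB] at h3

/-- The chain rule for independent distributions. -/
lemma independent (h : SeqAxioms r q D f) {n m : ℕ} (hn : 2 ≤ n) (hm : 2 ≤ m) {P p : ℕ → ℝ}
    (hP : Dist n P) (hp : Dist m p) :
    D (joint m P fun _ => p) = qAdd r (D P) (D p) := by
  obtain ⟨y, hy, h2, h3⟩ := h.chain n m hn hm P (fun _ => p) hP fun _ _ => hp
  rw [← sum_mul, ← sum_div, div_self hP.sum_rpow_pos.ne', one_mul] at h2
  rw [h3, h.gen_invertible hy (mem_values hp) h2]

/-- A point mass as first factor changes nothing, so `D (unif 1)` acts on every value as a neutral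
element. -/
lemma qAdd_point (h : SeqAxioms r q D f) {x : ℝ} (hx : x ∈ seqValues D) :
    D (unif 1) * (1 + (1 - r) * x) = 0 := by
  obtain ⟨n, p, hp, rfl⟩ := hx
  have hp2 := hp.mono (by omega : n ≤ n + 2)
  have := h.independent le_rfl (by omega) ((dist_unif le_rfl).mono one_le_two) hp2
  rw [joint_point hp2, qAdd] at this
  linarith

/-- A non-constant entropy vanishes on the point mass. -/
lemma point_eq_zero (h : SeqAxioms r q D f) (hD : (seqValues D).Nontrivial) :
    D (unif 1) = 0 := by
  obtain ⟨x, hx, y, hy, hxy⟩ := hD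
  by_contra h0
  have h1 := (mul_eq_zero.1 (h.qAdd_point hx)).resolve_left h0
  have h2 := (mul_eq_zero.1 (h.qAdd_point hy)).resolve_left h0
  rcases mul_eq_zero.1 (by linarith : (1 - r) * (x - y) = 0) with h3 | h3
  · rw [h3] at h1; norm_num at h1
  · exact hxy (by linarith)

lemma unif_mul (h : SeqAxioms r q D f) {n m : ℕ} (hn : 2 ≤ n) (hm : 2 ≤ m) :
    D (unif (n * m)) = qAdd r (D (unif n)) (D (unif m)) := by
  rw [← joint_unif (by omega)]
  exact h.independent hn hm (dist_unif (by omega)) (dist_unif (by omega))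

lemma unif_mono (h : SeqAxioms r q D f) {n m : ℕ} (hn : 1 ≤ n) (hnm : n ≤ m) (hm : 2 ≤ m) :
    D (unif n) ≤ D (unif m) :=
  h.maximal m _ hm ((dist_unif hn).mono hnm)

/-- Every value between zero and the maximum is attained. -/
lemma exists_eq (h : SeqAxioms r q D f) (h0 : D (unif 1) = 0) {m : ℕ} (hm : 1 ≤ m) {x : ℝ}
    (hx0 : 0 ≤ x) (hx : x ≤ D (unif m)) : ∃ p, Dist m p ∧ D p = x := by
  have h1 := (dist_unif le_rfl).mono hm
  have h2 := dist_unif hm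
  have hc := h.continuousOn m _ _ h1 h2
  have hmem := intermediate_value_Icc zero_le_one hc (show x ∈ Set.Icc _ _ by
    simp only [sub_zero, one_mul, zero_mul, add_zero, sub_self, zero_add]
    exact ⟨by rw [h0]; exact hx0, hx⟩)
  obtain ⟨t, ht, rfl⟩ := hmem
  exact ⟨_, dist_segment h1 h2 ht.1 ht.2, rfl⟩

lemma continuousOn_binary (h : SeqAxioms r q D f) :
    ContinuousOn (fun p => D (binary p)) (Set.Icc 0 1) := by
  have := h.continuousOn 2 _ _ (dist_binary le_rfl zero_le_one) (dist_binary zero_le_one le_rfl)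
  refine this.congr fun t _ => ?_
  congr 1; funext i
  rcases i with _ | _ | i <;> simp [binary]

/-- The uniform distribution does not have the absorbing value of the addition. -/
lemma one_add_unif_two_pos (h : SeqAxioms q q D f) (hD : (seqValues D).Nontrivial) :
    0 < 1 + (1 - q) * D (unif 2) := by
  have h0 := h.point_eq_zero hD
  rcases le_or_gt q 1 with hq | hq
  · nlinarith [h.nonneg 2 _ (dist_unif one_le_two)]
  -- For `q > 1` the quantity `E n = 1 + (1 - q) D (unif n)` is multiplicative and nonincreasing, so
  -- `E n ≥ E (n * n) = E n ^ 2 ≥ 0`.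
  have hE : ∀ n, 2 ≤ n → 0 ≤ 1 + (1 - q) * D (unif n) := fun n hn => by
    have h1 := h.unif_mono (by omega) (by nlinarith : n ≤ n * n) (by nlinarith)
    have h2 := h.unif_mul hn hn
    rw [qAdd] at h2
    nlinarith [sq_nonneg (1 + (1 - q) * D (unif n))]
  rcases (hE 2 le_rfl).lt_or_eq with h2 | h2
  · exact h2
  exfalso
  -- If `E 2 = 0`, then `M` is absorbing for `⊕_q` and is the largest value.
  set M := D (unif 2) with hM
  have hle : ∀ x ∈ seqValues D, x ≤ M := by
    rintro _ ⟨n, p, hp, rfl⟩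
    have h3 := h.maximal (n + 2) p (by omega) (hp.mono (by omega))
    have h4 := hE (n + 2) (by omega)
    nlinarith
  have hM0 : 0 < M := by
    rcases (h.nonneg 2 _ (dist_unif one_le_two)).lt_or_eq with h3 | h3
    · exact h3
    · rw [← hM] at h3; rw [← h3] at h2; norm_num at h2
  have hJ : seqValues D = Set.Icc 0 M := by
    ext x
    constructor
    · intro hx
      refine ⟨?_, hle x hx⟩
      obtain ⟨n, p, hp, rfl⟩ := hx
      exact h.nonneg n p hp
    · rintro ⟨hx0, hx1⟩
      obtain ⟨p, hp, rfl⟩ := h.exists_eq h0 one_le_two hx0 hx1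
      exact mem_values hp
  have hmono := ContinuousOn.strictMonoOn_of_injOn_Icc' hM0.le
    (hJ ▸ h.gen_continuous) (hJ ▸ h.gen_invertible)
  -- The last `p` in `[1/2, 1]` with binary value `M`: every larger weight gives another value.
  obtain ⟨p, ⟨⟨hp0, hp1⟩, hpM⟩, hmax⟩ : ∃ p, p ∈ {p ∈ Set.Icc (1 / 2 : ℝ) 1 | D (binary p) = M} ∧
      ∀ p' ∈ {p ∈ Set.Icc (1 / 2 : ℝ) 1 | D (binary p) = M}, p' ≤ p := by
    have hc : ContinuousOn (fun p => D (binary p)) (Set.Icc (1 / 2) 1) :=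
      h.continuousOn_binary.mono (Set.Icc_subset_Icc (by norm_num) le_rfl)
    have hcl := hc.preimage_isClosed_of_isClosed isClosed_Icc (isClosed_singleton (x := M))
    have hcpt : IsCompact {p ∈ Set.Icc (1 / 2 : ℝ) 1 | D (binary p) = M} :=
      isCompact_Icc.of_isClosed_subset hcl fun _ hx => hx.1
    obtain ⟨p, hp⟩ := hcpt.exists_isGreatest ⟨1 / 2, ⟨le_rfl, by norm_num⟩, by
      rw [binary_half]⟩
    exact ⟨p, hp.1, fun p' hp' => hp.2 hp'⟩
  have hp1' : p < 1 := by
    refine lt_of_le_of_ne hp1 ?_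
    rintro rfl
    rw [binary_one, h0] at hpM
    exact hM0.ne hpM
  have hδ := dist_unif (le_refl 1)
  -- The distribution `(p, 0, (1-p)/2, (1-p)/2)` has value `M`, because its first grouping has
  -- marginal value `M`, which absorbs. In the second grouping the marginal weight `p'` exceeds `p`,
  -- so the conditional value must be the absorbing one.
  obtain ⟨y, -, -, hy⟩ := h.chain_mix le_rfl (by linarith) hp1 (hδ.mono one_le_two)
    (dist_binary (p := 1 / 2) (by norm_num) (by norm_num))
  rw [mix_regroup (by linarith), hpM] at hy
  have hs : p / (p + (1 - p) * (1 / 2)) ≤ 1 := by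
    rw [div_le_one (by linarith)]; linarith
  have hA3 := dist_mix_point (div_nonneg (by linarith) (by linarith)) hs
  obtain ⟨y', hy', hfy, hDy⟩ := h.chain_mix (by norm_num : 2 ≤ 3)
    (by linarith : 0 ≤ p + (1 - p) * (1 / 2)) (by linarith) hA3 (hδ.mono (by norm_num))
  set p' := p + (1 - p) * (1 / 2) with hp'
  set x := D (binary p')
  have hxM : x ≠ M := fun hx => by
    have := hmax p' ⟨⟨by linarith, by linarith⟩, hx⟩
    linarith
  have hyM : y' = M := by
    rw [hDy, qAdd, qAdd] at hy
    have h3 : (1 + (1 - q) * x) * (1 + (1 - q) * y') = 0 := by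
      linear_combination (1 - q) * hy - (1 + (1 - q) * y) * h2
    rcases mul_eq_zero.1 h3 with h4 | h4
    · exact absurd (mul_left_cancel₀ (by linarith : (1 - q) ≠ 0) (by linarith)) hxM
    · exact mul_left_cancel₀ (by linarith : (1 - q) ≠ 0) (by linarith)
  have hmemA := hJ ▸ mem_values (D := D) hA3
  rw [hyM, h0] at hfy
  set a := D (mix 2 (p / p') (unif 1) (unif 1))
  have hp1 : 0 < (1 - p') ^ q := Real.rpow_pos_of_pos (by linarith) q
  have hp2 : 0 < p' ^ q := Real.rpow_pos_of_pos (by linarith) q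
  have hM' : M ∈ Set.Icc 0 M := ⟨hM0.le, le_rfl⟩
  have h0' : (0 : ℝ) ∈ Set.Icc 0 M := ⟨le_rfl, hM0.le⟩
  -- `f M` would be a mean of `f a` and `f 0` with positive weight on `f 0`; strict monotonicity of
  -- `f` on `[0, M]` forbids this.
  have hfy' : p' ^ q * (f a - f M) + (1 - p') ^ q * (f 0 - f M) = 0 := by
    field_simp at hfy; linarith
  rcases hmono with hm | hm
  · nlinarith [hm h0' hM' hM0, hm.monotoneOn hmemA hM' hmemA.2]
  · nlinarith [hm h0' hM' hM0, hm.antitoneOn hmemA hM' hmemA.2]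

/-- The values of a non-constant entropy lie in the domain of the `q`-logarithm. -/
lemma one_add_pos (h : SeqAxioms q q D f) (hD : (seqValues D).Nontrivial) {x : ℝ}
    (hx : x ∈ seqValues D) : 0 < 1 + (1 - q) * x := by
  have hpow : ∀ k : ℕ, 0 < 1 + (1 - q) * D (unif (2 ^ (k + 1))) := fun k => by
    induction k with
    | zero => simpa using h.one_add_unif_two_pos hD
    | succ k ih =>
      have h2 : 2 ≤ 2 ^ (k + 1) := by
        rw [pow_succ]; nlinarith [Nat.one_le_two_pow (n := k)]
      rw [pow_succ _ (k + 1), h.unif_mul h2 le_rfl, qAdd]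
      nlinarith [mul_pos ih (h.one_add_unif_two_pos hD)]
  obtain ⟨n, p, hp, rfl⟩ := hx
  have h0 := h.nonneg n p hp
  rcases le_or_gt q 1 with hq | hq
  · nlinarith
  · have h1 := h.maximal (2 ^ (n + 1)) p (by
      rw [pow_succ]; nlinarith [Nat.one_le_two_pow (n := n)])
      (hp.mono (Nat.lt_two_pow_self.le.trans (Nat.pow_le_pow_right two_pos (by omega))))
    nlinarith [hpow n]

end SeqAxioms

/-! ### The `q`-logarithm and escort weights -/

/-- The `q`-logarithm, which turns `qAdd q` into the ordinary addition. -/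
noncomputable def qLog (q x : ℝ) : ℝ := if q = 1 then x else Real.log (1 + (1 - q) * x) / (1 - q)

/-- The inverse of the `q`-logarithm. -/
noncomputable def qExp (q h : ℝ) : ℝ := if q = 1 then h else (Real.exp ((1 - q) * h) - 1) / (1 - q)

section QLog

variable {q x y : ℝ}

lemma qExp_qLog (hx : 0 < 1 + (1 - q) * x) : qExp q (qLog q x) = x := by
  unfold qExp qLog
  split_ifs with h
  · rfl
  · have h' : 1 - q ≠ 0 := sub_ne_zero.2 (Ne.symm h)
    rw [mul_div_cancel₀ _ h', Real.exp_log hx]; field_simp; ring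

lemma qLog_qAdd (hx : 0 < 1 + (1 - q) * x) (hy : 0 < 1 + (1 - q) * y) :
    qLog q (qAdd q x y) = qLog q x + qLog q y := by
  unfold qLog qAdd
  split_ifs with h
  · simp [h]
  · rw [← add_div, ← Real.log_mul hx.ne' hy.ne']; ring_nf

lemma qLog_mono (hx : 0 < 1 + (1 - q) * x) (hy : 0 < 1 + (1 - q) * y) (h : x ≤ y) :
    qLog q x ≤ qLog q y := by
  unfold qLog
  split_ifs with hq
  · exact h
  · rcases lt_or_gt_of_ne hq with hq | hq
    · exact div_le_div_of_nonneg_right (Real.log_le_log hx (by nlinarith)) (by linarith)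
    · exact div_le_div_of_nonpos_of_le (by linarith) (Real.log_le_log hy (by nlinarith))

lemma qLog_zero : qLog q 0 = 0 := by simp [qLog]

lemma continuousOn_qLog : ContinuousOn (qLog q) {x | 0 < 1 + (1 - q) * x} := by
  unfold qLog
  split_ifs with h
  · exact continuousOn_id
  · exact (ContinuousOn.log (by fun_prop) fun x hx => ne_of_gt hx).div_const _

lemma continuous_qExp : Continuous (qExp q) := by
  unfold qExp
  split_ifs with h
  · exact continuous_id
  · fun_prop

end QLog

/-- Normalising `w ^ (1 / q)` and `(1 - w) ^ (1 / q)` gives `p`. Thus two-point marginals realise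
all weighted means of two values. -/
lemma exists_escort {q w : ℝ} (hq : 0 < q) (h0 : 0 ≤ w) (h1 : w ≤ 1) :
    ∃ p : ℝ, 0 ≤ p ∧ p ≤ 1 ∧ p ^ q / (p ^ q + (1 - p) ^ q) = w ∧
      (1 - p) ^ q / (p ^ q + (1 - p) ^ q) = 1 - w := by
  have ha := Real.rpow_nonneg h0 (1 / q)
  have hb := Real.rpow_nonneg (sub_nonneg.2 h1) (1 / q)
  have haq : (w ^ (1 / q)) ^ q = w := by
    rw [← Real.rpow_mul h0, one_div_mul_cancel hq.ne', Real.rpow_one]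
  have hbq : ((1 - w) ^ (1 / q)) ^ q = 1 - w := by
    rw [← Real.rpow_mul (sub_nonneg.2 h1), one_div_mul_cancel hq.ne', Real.rpow_one]
  set a := w ^ (1 / q)
  set b := (1 - w) ^ (1 / q)
  have hab : 0 < a + b := by
    rcases ha.lt_or_eq with h | h
    · linarith
    rcases hb.lt_or_eq with h' | h'
    · linarith
    rw [← h, Real.zero_rpow hq.ne'] at haq
    rw [← h', Real.zero_rpow hq.ne'] at hbq
    linarith
  have h1p : 1 - a / (a + b) = b / (a + b) := by field_simp; ring
  have hs := Real.rpow_pos_of_pos hab q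
  refine ⟨a / (a + b), by positivity, by rw [div_le_one hab]; linarith, ?_, ?_⟩
  · rw [h1p, Real.div_rpow ha hab.le, Real.div_rpow hb hab.le, haq, hbq, ← add_div]
    field_simp; ring
  · rw [h1p, Real.div_rpow ha hab.le, Real.div_rpow hb hab.le, haq, hbq, ← add_div]
    field_simp; ring

/-! ### Additive entropies: uniform distributions and translations -/

namespace SeqAxioms

variable {r q : ℝ} {D H : (ℕ → ℝ) → ℝ} {f F : ℝ → ℝ}

/-- The `q`-logarithm of the entropy is additive. -/
theorem qLog_comp (h : SeqAxioms q q D f) (hD : (seqValues D).Nontrivial) :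
    SeqAxioms 1 q (fun p => qLog q (D p)) (fun x => f (qExp q x)) := by
  have hpos : ∀ {n p}, Dist n p → 0 < 1 + (1 - q) * D p :=
    fun hp => h.one_add_pos hD (mem_values hp)
  refine ⟨fun n p hp => ?_, fun n p p' hp hp' => ?_, fun n p hn hp => ?_, ?_, ?_, ?_⟩
  · rw [← qLog_zero (q := q)]
    exact qLog_mono (by simp) (hpos hp) (h.nonneg n p hp)
  · exact continuousOn_qLog.comp (h.continuousOn n p p' hp hp')
      fun t ht => hpos (dist_segment hp hp' ht.1 ht.2)
  · exact qLog_mono (hpos hp) (hpos (dist_unif (by omega))) (h.maximal n p hn hp)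
  · refine h.gen_continuous.comp continuous_qExp.continuousOn ?_
    rintro _ ⟨n, p, hp, rfl⟩
    simp only [qExp_qLog (hpos hp)]
    exact mem_values hp
  · rintro _ ⟨n, p, hp, rfl⟩ _ ⟨n', p', hp', rfl⟩ he
    simp only [qExp_qLog (hpos hp), qExp_qLog (hpos hp')] at he
    simp only [h.gen_invertible (mem_values hp) (mem_values hp') he]
  · intro n m hn hm P Q hP hQ
    obtain ⟨y, ⟨k, p, hp, rfl⟩, h2, h3⟩ := h.chain n m hn hm P Q hP hQ
    refine ⟨qLog q (D p), ⟨k, p, hp, rfl⟩, ?_, ?_⟩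
    · simp only [qExp_qLog (hpos hp)]
      rw [h2]
      refine sum_congr rfl fun i hi => ?_
      rw [qExp_qLog (hpos (hQ i (mem_range.1 hi)))]
    · simp only [h3]
      rw [qLog_qAdd (hpos hP) (hpos hp)]
      simp [qAdd]

lemma unif_pow (h : SeqAxioms 1 q H F) (h0 : H (unif 1) = 0) {n : ℕ} (hn : 2 ≤ n) (k : ℕ) :
    H (unif (n ^ k)) = k * H (unif n) := by
  induction k with
  | zero => simp [h0]
  | succ k ih =>
    rcases Nat.eq_zero_or_pos k with rfl | hk
    · simp
    · rw [pow_succ, h.unif_mul (hn.trans (Nat.le_self_pow hk.ne' n)) hn, ih, qAdd]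
      push_cast; ring

/-- Shannon's argument: with `n ^ k` between consecutive powers of two, monotonicity bounds `k`
times the discrepancy independently of `k`. -/
lemma unif_eq_log (h : SeqAxioms 1 q H F) (h0 : H (unif 1) = 0) {n : ℕ} (hn : 2 ≤ n) :
    H (unif n) = H (unif 2) / Real.log 2 * Real.log n := by
  have hlog2 : 0 < Real.log 2 := Real.log_pos one_lt_two
  have hg2 : 0 ≤ H (unif 2) := h.nonneg 2 _ (dist_unif one_le_two)
  have key : ∀ k : ℕ, 1 ≤ k →
      (k : ℝ) * |H (unif n) * Real.log 2 - H (unif 2) * Real.log n| ≤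
        H (unif 2) * Real.log 2 := fun k hk => by
    set j := Nat.log 2 (n ^ k)
    have hnk : 2 ≤ n ^ k := hn.trans (Nat.le_self_pow (by omega) n)
    have h1 : 2 ^ j ≤ n ^ k := Nat.pow_log_le_self 2 (by omega)
    have h2 : n ^ k < 2 ^ (j + 1) := Nat.lt_pow_succ_log_self one_lt_two _
    have a1 := h.unif_mono (Nat.one_le_two_pow) h1 hnk
    have a2 := h.unif_mono (by omega) h2.le (by omega)
    rw [h.unif_pow h0 le_rfl, h.unif_pow h0 hn] at a1 a2
    have b1 : (j : ℝ) * Real.log 2 ≤ k * Real.log n := by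
      rw [← Real.log_pow, ← Real.log_pow]
      exact Real.log_le_log (by positivity) (by exact_mod_cast h1)
    have b2 : k * Real.log n ≤ ((j + 1 : ℕ) : ℝ) * Real.log 2 := by
      rw [← Real.log_pow, ← Real.log_pow]
      exact Real.log_le_log (by positivity) (by exact_mod_cast h2.le)
    push_cast at a2 b2
    rw [← Nat.abs_cast k, ← abs_mul, abs_le]
    constructor <;> nlinarith
  have hzero : H (unif n) * Real.log 2 - H (unif 2) * Real.log n = 0 := by
    by_contra hne
    have hpos := abs_pos.2 hne
    obtain ⟨k, hk⟩ := exists_nat_gt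
      (H (unif 2) * Real.log 2 / |H (unif n) * Real.log 2 - H (unif 2) * Real.log n|)
    rw [div_lt_iff₀ hpos] at hk
    have hk1 : 1 ≤ k := by
      rcases Nat.eq_zero_or_pos k with rfl | hk'
      · simp at hk; nlinarith
      · exact hk'
    linarith [key k hk1]
  field_simp; linarith

/-- Otherwise all uniform values vanish by `unif_eq_log`, and maximality makes `H` identically zero.
-/
lemma unif_two_pos (h : SeqAxioms 1 q H F) (hH : (seqValues H).Nontrivial) :
    0 < H (unif 2) := by
  refine lt_of_le_of_ne (h.nonneg 2 _ (dist_unif one_le_two)) fun h2 => ?_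
  have h0 := h.point_eq_zero hH
  have hz : ∀ x ∈ seqValues H, x = 0 := by
    rintro _ ⟨n, p, hp, rfl⟩
    have := h.maximal (n + 2) p (by omega) (hp.mono (by omega))
    rw [h.unif_eq_log h0 (by omega), ← h2] at this
    simp only [zero_div, zero_mul] at this
    exact le_antisymm this (h.nonneg n p hp)
  obtain ⟨x, hx, y, hy, hxy⟩ := hH
  exact hxy ((hz x hx).trans (hz y hy).symm)

/-- Every nonnegative number is a value of a non-constant additive entropy. -/
lemma exists_dist_eq (h : SeqAxioms 1 q H F) (hH : (seqValues H).Nontrivial) {x : ℝ}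
    (hx : 0 ≤ x) : ∃ N, 2 ≤ N ∧ ∃ p, Dist N p ∧ H p = x := by
  have h0 := h.point_eq_zero hH
  have h2 := h.unif_two_pos hH
  obtain ⟨k, hk⟩ := exists_nat_ge (x / H (unif 2))
  rw [div_le_iff₀ h2] at hk
  refine ⟨2 ^ (k + 1), by rw [pow_succ]; nlinarith [Nat.one_le_two_pow (n := k)],
    h.exists_eq h0 Nat.one_le_two_pow hx ?_⟩
  rw [h.unif_pow h0 le_rfl]
  push_cast; nlinarith

lemma seqValues_eq (h : SeqAxioms 1 q H F) (hH : (seqValues H).Nontrivial) :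
    seqValues H = Set.Ici 0 := by
  ext x
  constructor
  · rintro ⟨n, p, hp, rfl⟩; exact h.nonneg n p hp
  · intro hx
    obtain ⟨N, _, p, hp, rfl⟩ := h.exists_dist_eq hH hx
    exact mem_values hp

/-- The quasi-arithmetic means given by the generator commute with translations. -/
lemma translate (hq : 0 < q) (h : SeqAxioms 1 q H F) (hH : (seqValues H).Nontrivial)
    {x y z t w : ℝ} (hx : 0 ≤ x) (hy : 0 ≤ y) (hz : 0 ≤ z) (ht : 0 ≤ t) (hw0 : 0 ≤ w)
    (hw1 : w ≤ 1) (hF : F z = w * F x + (1 - w) * F y) :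
    F (z + t) = w * F (x + t) + (1 - w) * F (y + t) := by
  obtain ⟨N, hN, X, hX, rfl⟩ := h.exists_dist_eq hH hx
  obtain ⟨N', hN', Y, hY, rfl⟩ := h.exists_dist_eq hH hy
  obtain ⟨k, hk, T, hT, rfl⟩ := h.exists_dist_eq hH ht
  obtain ⟨p, hp0, hp1, hpw, hpw'⟩ := exists_escort hq hw0 hw1
  set m := max N N'
  have hm : 2 ≤ m := hN.trans (le_max_left _ _)
  have hmk : 2 ≤ m * k := by nlinarith
  replace hX : Dist m X := hX.mono (le_max_left _ _)
  replace hY : Dist m Y := hY.mono (le_max_right _ _)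
  have hP := dist_binary hp0 hp1
  have hQ : ∀ i < 2, Dist m (if i = 0 then X else Y) := fun i _ => by
    by_cases hi : i = 0 <;> simp [hi, hX, hY]
  obtain ⟨u, hu, hu1, hu2⟩ := h.chain 2 m le_rfl hm _ _ hP hQ
  obtain ⟨v, hv, hv1, hv2⟩ := h.chain 2 (m * k) le_rfl hmk _
    (fun i => joint k (if i = 0 then X else Y) fun _ => T) hP
    fun i hi => dist_joint (by omega) (hQ i hi) fun _ _ => hT
  have hR := dist_joint (by omega) hP hQ
  -- Appending `T` to the joint distribution or to each conditional distribution gives the same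
  -- result, whence `v = u + H T`.
  have hind := h.independent (by omega) hk hR hT
  rw [joint_joint, hv2, hu2] at hind
  simp only [sum_range_succ, range_zero, sum_empty, zero_add, if_true, one_ne_zero, if_false,
    h.independent hm hk hX hT, h.independent hm hk hY hT] at hu1 hv1
  simp only [binary, if_true, one_ne_zero, if_false, hpw, hpw'] at hu1 hv1
  have hzu : u = z := h.gen_invertible hu (h.seqValues_eq hH ▸ hz) (by rw [hu1, hF])
  have hvz : v = z + H T := by
    simp only [qAdd] at hind; rw [hzu] at hind; linarith
  rw [← hvz, hv1]
  simp [qAdd]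

end SeqAxioms

/-! ### The functional equation for the generator -/

/-- A continuous additive function on `[0, ∞)` is linear. -/
lemma linear_of_additive {g : ℝ → ℝ} (hc : ContinuousOn g (Set.Ici 0))
    (hadd : ∀ x y, 0 ≤ x → 0 ≤ y → g (x + y) = g x + g y) {x : ℝ} (hx : 0 ≤ x) :
    g x = g 1 * x := by
  have h0 : g 0 = 0 := by have := hadd 0 0 le_rfl le_rfl; simp at this; exact this
  -- The odd extension of `g` is a continuous additive map on the whole line.
  let φ : ℝ →+ ℝ :=
    { toFun := fun x => g (max x 0) - g (max (-x) 0)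
      map_zero' := by simp
      map_add' := fun x y => by
        have h1 := hadd (max (x + y) 0 + max (-x) 0) (max (-y) 0) (by positivity) (by positivity)
        have h2 := hadd (max (x + y) 0) (max (-x) 0) (by positivity) (by positivity)
        have h3 := hadd (max (-(x + y)) 0 + max x 0) (max y 0) (by positivity) (by positivity)
        have h4 := hadd (max (-(x + y)) 0) (max x 0) (by positivity) (by positivity)
        have e : ∀ z : ℝ, max z 0 - max (-z) 0 = z := fun z => by
          rcases le_total 0 z with hz | hz
          · rw [max_eq_left hz, max_eq_right (by linarith)]; ring
          · rw [max_eq_right hz, max_eq_left (by linarith)]; ring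
        have h5 : max (x + y) 0 + max (-x) 0 + max (-y) 0 =
            max (-(x + y)) 0 + max x 0 + max y 0 := by
          linarith [e x, e y, e (x + y)]
        rw [h5] at h1
        linarith }
  have hφ : Continuous φ := by
    refine Continuous.sub ?_ ?_
    · exact hc.comp_continuous (by fun_prop) fun x => Set.mem_Ici.2 (le_max_right _ _)
    · exact hc.comp_continuous (by fun_prop) fun x => Set.mem_Ici.2 (le_max_right _ _)
  have key := (φ.toRealLinearMap hφ).map_smul x 1
  have e : ∀ z, 0 ≤ z → φ z = g z := fun z hz => by
    change g (max z 0) - g (max (-z) 0) = g z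
    rw [max_eq_left hz, max_eq_right (by linarith), h0, sub_zero]
  simp only [smul_eq_mul, mul_one, AddMonoidHom.coe_toRealLinearMap] at key
  rw [e x hx, e 1 zero_le_one] at key
  linarith

/-- A continuous injective function whose quasi-arithmetic means commute with translations is
affine or an affine function of an exponential function. -/
theorem generator_of_translate {F : ℝ → ℝ} (hc : ContinuousOn F (Set.Ici 0))
    (hinj : Set.InjOn F (Set.Ici 0))
    (htr : ∀ x y z t w : ℝ, 0 ≤ x → 0 ≤ y → 0 ≤ z → 0 ≤ t → 0 ≤ w → w ≤ 1 →
      F z = w * F x + (1 - w) * F y → F (z + t) = w * F (x + t) + (1 - w) * F (y + t)) :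
    ∃ a b : ℝ, a ≠ 0 ∧ ((∀ x, 0 ≤ x → F x = a * x + b) ∨
      ∃ l : ℝ, l ≠ 0 ∧ ∀ x, 0 ≤ x → F x = a * Real.exp (l * x) + b) := by
  obtain ⟨G, hG⟩ : ∃ G : ℝ → ℝ, ∀ x, F x = G x + F 0 := ⟨fun x => F x - F 0, fun x => by ring⟩
  have hG0 : G 0 = 0 := by linarith [hG 0]
  have hGinj : Set.InjOn G (Set.Ici 0) := fun x hx y hy h => hinj hx hy (by rw [hG, hG y, h])
  have hGc : ContinuousOn G (Set.Ici 0) :=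
    (hc.sub continuousOn_const).congr fun x _ => by
      change G x = F x - F 0; linarith [hG x]
  have hG1 : G 1 ≠ 0 := fun h =>
    zero_ne_one (hGinj Set.self_mem_Ici (Set.mem_Ici.2 zero_le_one) (by rw [hG0, h]))
  have hsign : ∀ x, 0 ≤ x → 0 ≤ G x / G 1 := fun x hx => by
    have hsub : Set.Icc 0 (x + 1) ⊆ Set.Ici (0 : ℝ) := fun _ h => h.1
    have m0 : (0 : ℝ) ∈ Set.Icc 0 (x + 1) := ⟨le_rfl, by linarith⟩
    have m1 : (1 : ℝ) ∈ Set.Icc 0 (x + 1) := ⟨zero_le_one, by linarith⟩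
    have mx : x ∈ Set.Icc 0 (x + 1) := ⟨hx, by linarith⟩
    rcases ContinuousOn.strictMonoOn_of_injOn_Icc' (by linarith : 0 ≤ x + 1) (hGc.mono hsub)
      (hGinj.mono hsub) with hm | hm
    · have h1 := hm.monotoneOn m0 mx hx
      have h2 := hm.monotoneOn m0 m1 zero_le_one
      rw [hG0] at h1 h2
      exact div_nonneg h1 h2
    · have h1 := hm.antitoneOn m0 mx hx
      have h2 := hm.antitoneOn m0 m1 zero_le_one
      rw [hG0] at h1 h2
      exact div_nonneg_of_nonpos h1 h2
  have haff : ∀ x t, 0 ≤ x → 0 ≤ t → G (x + t) = G t + G x / G 1 * (G (1 + t) - G t) := by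
    intro x t hx ht
    have hs := hsign x hx
    -- If the ratio is at most `1`, it is the weight making `x` a mean of `1` and `0`; otherwise its
    -- inverse makes `1` a mean of `x` and `0`.
    rcases le_or_gt (G x / G 1) 1 with h1 | h1
    · have := htr 1 0 x t (G x / G 1) zero_le_one le_rfl hx ht hs h1 (by
        rw [hG x, hG 1, mul_add, div_mul_cancel₀ _ hG1]; ring)
      rw [zero_add, hG (x + t), hG (1 + t), hG t] at this
      linarith
    · have hpos : 0 < G x / G 1 := by linarith
      have hx0 : G x ≠ 0 := fun h => by rw [h, zero_div] at hpos; exact lt_irrefl _ hpos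
      have := htr x 0 1 t (G x / G 1)⁻¹ hx le_rfl zero_le_one ht (inv_nonneg.2 hs)
        (inv_le_one_of_one_le₀ h1.le) (by
          rw [hG x, hG 1]; field_simp; ring)
      rw [zero_add, hG (x + t), hG (1 + t), hG t] at this
      field_simp at this ⊢
      linarith
  set A : ℝ → ℝ := fun t => (G (1 + t) - G t) / G 1 with hA
  have hadd : ∀ x t, 0 ≤ x → 0 ≤ t → G (x + t) = G t + A t * G x := fun x t hx ht => by
    rw [haff x t hx ht, hA]; field_simp
  -- Expanding `G (x + 1)` in both orders shows that `A - 1` is proportional to `G`.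
  obtain ⟨κ, hκ⟩ : ∃ κ, ∀ x, 0 ≤ x → A x = 1 + κ * G x := by
    refine ⟨(A 1 - 1) / G 1, fun x hx => ?_⟩
    have h1 := hadd x 1 hx zero_le_one
    have h2 := hadd 1 x zero_le_one hx
    rw [add_comm, h2] at h1
    field_simp
    linarith
  rcases eq_or_ne κ 0 with rfl | hκ0
  · refine ⟨G 1, F 0, hG1, Or.inl fun x hx => ?_⟩
    rw [hG, linear_of_additive hGc (fun x y hx hy => ?_) hx]
    rw [hadd x y hx hy, hκ y hy]; ring
  · have hmul : ∀ x t, 0 ≤ x → 0 ≤ t → A (x + t) = A x * A t := fun x t hx ht => by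
      rw [hκ _ (add_nonneg hx ht), hadd x t hx ht, hκ x hx, hκ t ht]; ring
    -- A zero of `A` at `x` recurs at `x + 1`, so `G` would take the same value at both points.
    have hAne : ∀ x, 0 ≤ x → A x ≠ 0 := fun x hx h0 => by
      have h1 := hmul x 1 hx zero_le_one
      rw [h0, zero_mul, hκ _ (by linarith), ← h0, hκ x hx] at h1
      have h2 := hGinj (Set.mem_Ici.2 (by linarith : 0 ≤ x + 1)) (Set.mem_Ici.2 hx)
        (mul_left_cancel₀ hκ0 (by linarith))
      linarith
    have hApos : ∀ x, 0 ≤ x → 0 < A x := fun x hx => by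
      have h1 := hmul (x / 2) (x / 2) (by linarith) (by linarith)
      rw [add_halves] at h1
      rw [h1]
      exact mul_self_pos.2 (hAne _ (by linarith))
    have hAc : ContinuousOn A (Set.Ici 0) :=
      ((hGc.const_smul κ).const_add 1).congr fun x hx => by simpa using hκ x hx
    have hlog : ∀ x, 0 ≤ x → Real.log (A x) = Real.log (A 1) * x := fun x hx =>
      linear_of_additive (g := fun x => Real.log (A x)) (hAc.log fun x hx => hAne x hx)
        (fun x y hx hy => by
          rw [hmul x y hx hy, Real.log_mul (hAne x hx) (hAne y hy)]) hx
    have hAexp : ∀ x, 0 ≤ x → A x = Real.exp (Real.log (A 1) * x) := fun x hx => by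
      rw [← hlog x hx, Real.exp_log (hApos x hx)]
    refine ⟨κ⁻¹, F 0 - κ⁻¹, inv_ne_zero hκ0, Or.inr ⟨Real.log (A 1), fun h0 => ?_, fun x hx => ?_⟩⟩
    · have h1 := hAexp 1 zero_le_one
      rw [h0, zero_mul, Real.exp_zero, hκ 1 zero_le_one] at h1
      exact mul_ne_zero hκ0 hG1 (by linarith)
    · rw [← hAexp x hx, hκ x hx, hG]; field_simp; ring

/-! ### Relating the generator to `q` through five points -/

/-- The distribution `(2, 2, 1) / 5`. -/
noncomputable def twoTwoOne : ℕ → ℝ := mix 2 (4 / 5) (unif 2) (unif 1)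

lemma dist_twoTwoOne : Dist 3 twoTwoOne := by
  have h : Dist 4 twoTwoOne := dist_mix two_pos (by norm_num) (by norm_num) (dist_unif one_le_two)
    ((dist_unif le_rfl).mono one_le_two)
  refine ⟨h.nonneg, fun i hi => ?_, ?_⟩
  · rcases hi.eq_or_lt with rfl | hi
    · simp [twoTwoOne, mix, unif]
    · exact h.zero i hi
  · simp [sum_range_succ, twoTwoOne, mix, unif]; norm_num

lemma joint_twoTwoOne :
    joint 2 twoTwoOne (fun i => if i < 2 then unif 2 else unif 1) = unif 5 := by
  funext k
  rcases lt_or_ge k 6 with hk | hk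
  · interval_cases k <;> simp [joint, twoTwoOne, mix, unif] <;> norm_num
  · have h3 : 3 ≤ k / 2 := by omega
    simp [joint, dist_twoTwoOne.zero _ h3, unif, show ¬ k < 5 by omega]

namespace SeqAxioms

variable {q : ℝ} {H : (ℕ → ℝ) → ℝ} {F : ℝ → ℝ}

/-- The chain rules for the uniform distribution on five points and for `(2, 2, 1) / 5`. -/
lemma five_relations (h : SeqAxioms 1 q H F) (h0 : H (unif 1) = 0) :
    ∃ s u v w : ℝ, 0 ≤ u ∧ 0 ≤ v ∧ 0 ≤ w ∧ s + u = s + v + w ∧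
      F u * ((2 ^ q) ^ 2 + 1) = (2 ^ q) ^ 2 * F (2 * H (unif 2)) + F 0 ∧
      F v * ((2 ^ q) ^ 2 + 1) = (2 ^ q) ^ 2 * F (H (unif 2)) + F 0 ∧
      F w * (2 * 2 ^ q + 1) = 2 * 2 ^ q * F (H (unif 2)) + F 0 := by
  have hδ := dist_unif (le_refl 1)
  have hJ : ∀ x ∈ seqValues H, 0 ≤ x := by
    rintro _ ⟨n, p, hp, rfl⟩; exact h.nonneg n p hp
  have h4 : H (unif 4) = 2 * H (unif 2) := by
    have := h.unif_pow h0 le_rfl 2; norm_num at this; exact this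
  obtain ⟨u, hu, hu1, hu2⟩ := h.chain_mix (m := 4) (p := 4 / 5) (by norm_num) (by norm_num)
    (by norm_num) (dist_unif (by norm_num)) (hδ.mono (by norm_num))
  obtain ⟨v, hv, hv1, hv2⟩ := h.chain_mix (m := 2) (p := 4 / 5) le_rfl (by norm_num)
    (by norm_num) (dist_unif (by norm_num)) (hδ.mono (by norm_num))
  obtain ⟨w, hw, hw1, hw2⟩ := h.chain 3 2 (by norm_num) le_rfl twoTwoOne
    (fun i => if i < 2 then unif 2 else unif 1) dist_twoTwoOne (fun i _ => by
      by_cases hi : i < 2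
      · simpa [hi] using dist_unif one_le_two
      · simpa [hi] using hδ.mono one_le_two)
  have h5 : mix 4 (4 / 5) (unif 4) (unif 1) = unif 5 := by
    have := mix_unif (m := 4) (r := 1) (by norm_num) (by norm_num)
    norm_num at this; exact this
  have e4 : (4 / 5 : ℝ) ^ q = (2 ^ q) ^ 2 / 5 ^ q := by
    rw [Real.div_rpow (by norm_num) (by norm_num), show (4 : ℝ) = 2 * 2 by norm_num,
      Real.mul_rpow (by norm_num) (by norm_num), sq]
  have e2 : (2 / 5 : ℝ) ^ q = 2 ^ q / 5 ^ q := Real.div_rpow (by norm_num) (by norm_num) q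
  have e1 : (1 / 5 : ℝ) ^ q = 1 / 5 ^ q := by
    rw [Real.div_rpow (by norm_num) (by norm_num), Real.one_rpow]
  have t0 : twoTwoOne 0 = 2 / 5 := by simp [twoTwoOne, mix, unif]; norm_num
  have t1 : twoTwoOne 1 = 2 / 5 := by simp [twoTwoOne, mix, unif]; norm_num
  have t2 : twoTwoOne 2 = 1 / 5 := by simp [twoTwoOne, mix, unif]; norm_num
  have p5 : (0 : ℝ) < 5 ^ q := by positivity
  have p2 : (0 : ℝ) < 2 ^ q := by positivity
  rw [show (1 : ℝ) - 4 / 5 = 1 / 5 by norm_num, e4, e1, h0] at hu1 hv1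
  simp only [sum_range_succ, range_zero, sum_empty, zero_add, t0, t1, t2, e1, e2] at hw1
  norm_num [h0] at hw1
  rw [h4] at hu1
  rw [h5] at hu2
  rw [joint_twoTwoOne, hu2] at hw2
  change H twoTwoOne = _ at hv2
  rw [hv2] at hw2
  simp only [qAdd, sub_self, zero_mul, add_zero] at hw2
  -- Here `s = H (binary (4 / 5))`. It occurs in both splittings, since `(2, 2, 1) / 5` itself
  -- splits along `(4, 1) / 5`.
  refine ⟨_, u, v, w, hJ u hu, hJ v hv, hJ w hw, hw2, ?_, ?_, ?_⟩
  · rw [hu1]; field_simp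
  · rw [hv1]; field_simp
  · rw [hw1]; field_simp; ring

/-- If the generator is affine, then `q = 1`. -/
lemma eq_one_of_affine (h : SeqAxioms 1 q H F) (hH : (seqValues H).Nontrivial) {a b : ℝ}
    (ha : a ≠ 0) (hF : ∀ x, 0 ≤ x → F x = a * x + b) : q = 1 := by
  obtain ⟨s, u, v, w, hu, hv, hw, he, h1, h2, h3⟩ := h.five_relations (h.point_eq_zero hH)
  have hL := h.unif_two_pos hH
  rw [hF u hu, hF _ (by linarith), hF 0 le_rfl] at h1
  rw [hF v hv, hF _ hL.le, hF 0 le_rfl] at h2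
  rw [hF w hw, hF _ hL.le, hF 0 le_rfl] at h3
  have p2 : (0 : ℝ) < 2 ^ q := by positivity
  set x : ℝ := 2 ^ q with hx
  set L := H (unif 2)
  have e1 : u * (x ^ 2 + 1) = x ^ 2 * (2 * L) := mul_left_cancel₀ ha (by linarith)
  have e2 : v * (x ^ 2 + 1) = x ^ 2 * L := mul_left_cancel₀ ha (by linarith)
  have e3 : w * (2 * x + 1) = 2 * x * L := mul_left_cancel₀ ha (by linarith)
  have e4 : u = v + w := by linarith
  -- Eliminating `u`, `v`, `w` from `u = v + w` leaves an equation for `x = 2 ^ q` alone, as `L >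
  -- 0`.
  have e5 : x * L * (x - 2) = 0 := by
    rw [e4] at e1
    linear_combination (2 * x + 1) * e2 + (x ^ 2 + 1) * e3 - (2 * x + 1) * e1
  have e6 : x = 2 := by
    rcases mul_eq_zero.1 e5 with h' | h'
    · exact absurd h' (by positivity)
    · linarith
  have := congrArg Real.log (hx.symm.trans e6)
  rw [Real.log_rpow two_pos] at this
  exact mul_right_cancel₀ (Real.log_pos one_lt_two).ne' (by linarith)

/-- If the generator is exponential, then its exponent is determined by the entropy. -/
lemma exponent_eq (h : SeqAxioms 1 q H F) (hH : (seqValues H).Nontrivial) {a b l : ℝ}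
    (ha : a ≠ 0) (hl : l ≠ 0) (hF : ∀ x, 0 ≤ x → F x = a * Real.exp (l * x) + b) :
    l * (H (unif 2) / Real.log 2) = 1 - q := by
  obtain ⟨s, u, v, w, hu, hv, hw, he, h1, h2, h3⟩ := h.five_relations (h.point_eq_zero hH)
  have hL := h.unif_two_pos hH
  rw [hF u hu, hF _ (by linarith), hF 0 le_rfl, mul_zero, Real.exp_zero] at h1
  rw [hF v hv, hF _ hL.le, hF 0 le_rfl, mul_zero, Real.exp_zero] at h2
  rw [hF w hw, hF _ hL.le, hF 0 le_rfl, mul_zero, Real.exp_zero] at h3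
  have p2 : (0 : ℝ) < 2 ^ q := by positivity
  have hlog2 : 0 < Real.log 2 := Real.log_pos one_lt_two
  rw [show l * (2 * H (unif 2)) = l * H (unif 2) + l * H (unif 2) by ring, Real.exp_add,
    show l * u = l * v + l * w by rw [← mul_add]; congr 1; linarith, Real.exp_add] at h1
  set x : ℝ := 2 ^ q with hx
  set L := H (unif 2)
  set X := Real.exp (l * L) with hX
  set V := Real.exp (l * v)
  set W := Real.exp (l * w)
  have pX : 0 < X := Real.exp_pos _
  have e1 : V * W * (x ^ 2 + 1) = x ^ 2 * (X * X) + 1 := mul_left_cancel₀ ha (by linarith)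
  have e2 : V * (x ^ 2 + 1) = x ^ 2 * X + 1 := mul_left_cancel₀ ha (by linarith)
  have e3 : W * (2 * x + 1) = 2 * x * X + 1 := mul_left_cancel₀ ha (by linarith)
  -- `exp (l u) = V * W` eliminates the unknown values. The factor `X - 1` is nonzero because `l L ≠
  -- 0`, so `2 ^ q * exp (l L) = 2`.
  have e4 : x * (X - 1) * (x * X - 2) = 0 := by
    have : (x ^ 2 * X + 1) * (2 * x * X + 1) = (x ^ 2 * (X * X) + 1) * (2 * x + 1) := by
      rw [← e1, ← e2, ← e3]; ring
    linear_combination -this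
  have hX1 : X - 1 ≠ 0 := fun h' => by
    have : l * L = 0 := (Real.exp_eq_one_iff _).1 (by linarith)
    exact mul_ne_zero hl hL.ne' this
  have e5 : x * X = 2 := by
    rcases mul_eq_zero.1 e4 with h' | h'
    · exact absurd h' (mul_ne_zero p2.ne' hX1)
    · linarith
  have := congrArg Real.log e5
  rw [Real.log_mul p2.ne' pX.ne', hx, hX, Real.log_exp, Real.log_rpow two_pos] at this
  field_simp; linarith

end SeqAxioms

/-! ### Uniqueness of an additive entropy with given generator -/

lemma eq_binary {p : ℕ → ℝ} (h : Dist 2 p) : p = binary (p 0) := by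
  funext i
  rcases i with _ | _ | i
  · simp [binary]
  · have := h.sum
    simp only [sum_range_succ, range_zero, sum_empty, zero_add] at this
    simp [binary]; linarith
  · simp [binary, h.zero (i + 2) (by omega)]

/-- Every distribution on `2 m` points is given by two conditional distributions on `m` points. -/
lemma exists_eq_mix {m : ℕ} (hm : 0 < m) {p : ℕ → ℝ} (h : Dist (2 * m) p) :
    ∃ s A B, 0 ≤ s ∧ s ≤ 1 ∧ Dist m A ∧ Dist m B ∧ p = mix m s A B := by
  have key : ∀ g : ℕ → ℝ, (∀ i, 0 ≤ g i) → (∀ i, m ≤ i → g i = 0) →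
      ∃ A, Dist m A ∧ ∀ i, g i = (∑ j ∈ range m, g j) * A i := by
    intro g hg hz
    rcases (sum_nonneg fun j (_ : j ∈ range m) => hg j).lt_or_eq with hs | hs
    · refine ⟨fun i => g i / ∑ j ∈ range m, g j, ⟨fun i => div_nonneg (hg i) hs.le,
        fun i hi => by rw [hz i hi, zero_div], ?_⟩, fun i => by field_simp⟩
      rw [← sum_div, div_self hs.ne']
    · refine ⟨unif 1, (dist_unif le_rfl).mono hm, fun i => ?_⟩
      rw [← hs, zero_mul]
      rcases lt_or_ge i m with hi | hi
      · exact (sum_eq_zero_iff_of_nonneg fun j _ => hg j).1 hs.symm i (mem_range.2 hi)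
      · exact hz i hi
  obtain ⟨A, hA, hA'⟩ := key (fun i => if i < m then p i else 0)
    (fun i => by split_ifs; exacts [h.nonneg i, le_rfl]) (fun i hi => by simp [hi])
  obtain ⟨B, hB, hB'⟩ := key (fun i => p (m + i)) (fun i => h.nonneg _)
    (fun i hi => h.zero _ (by omega))
  have hs : ∑ j ∈ range m, (if j < m then p j else 0) = ∑ j ∈ range m, p j :=
    sum_congr rfl fun j hj => by simp [mem_range.1 hj]
  have htot := h.sum
  rw [two_mul, sum_range_add] at htot
  have h1 : 0 ≤ ∑ j ∈ range m, p j := sum_nonneg fun j _ => h.nonneg j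
  have h2 : 0 ≤ ∑ j ∈ range m, p (m + j) := sum_nonneg fun j _ => h.nonneg _
  refine ⟨∑ j ∈ range m, p j, A, B, h1, by linarith, hA, hB, ?_⟩
  funext k
  by_cases hk : k < m
  · have := hA' k
    rw [hs] at this
    simpa [mix, hk] using this
  · have := hB' (k - m)
    rw [Nat.add_sub_cancel' (by omega)] at this
    simp only [mix, hk, if_false]
    rw [this, ← htot, add_sub_cancel_left]

namespace SeqAxioms

variable {q : ℝ} {H H' : (ℕ → ℝ) → ℝ} {F : ℝ → ℝ}

/-- The conditional value depends only on `F` and on the values at `A` and `B`. So agreement on `mix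
m p A B` and on `binary p` are equivalent. -/
lemma mix_sub_eq (h : SeqAxioms 1 q H F) (h' : SeqAxioms 1 q H' F)
    (hH : (seqValues H).Nontrivial) (hH' : (seqValues H').Nontrivial)
    {m : ℕ} (hm : 2 ≤ m) {p : ℝ} (h0 : 0 ≤ p) (h1 : p ≤ 1) {A B : ℕ → ℝ} (hA : Dist m A)
    (hB : Dist m B) (eA : H A = H' A) (eB : H B = H' B) :
    H (mix m p A B) - H (binary p) = H' (mix m p A B) - H' (binary p) := by
  obtain ⟨y, hy, h2, h3⟩ := h.chain_mix hm h0 h1 hA hB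
  obtain ⟨y', hy', h2', h3'⟩ := h'.chain_mix hm h0 h1 hA hB
  have hyy : y = y' := by
    refine h.gen_invertible hy ?_ (by rw [h2, h2', eA, eB])
    rwa [h.seqValues_eq hH, ← h'.seqValues_eq hH']
  rw [h3, h3', hyy]; simp [qAdd]

/-- Splitting `unif (m + r)` into `unif m` and `unif r` settles the weight `m / (m + r)`; both parts
must fit in blocks of length `m`, whence `r ≤ m` and `p ≥ 1/2`. Continuity and density of the
rationals do the rest. -/
lemma binary_eq_of_half_le (h : SeqAxioms 1 q H F) (h' : SeqAxioms 1 q H' F)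
    (hH : (seqValues H).Nontrivial) (hH' : (seqValues H').Nontrivial)
    (hu : ∀ n, 1 ≤ n → H (unif n) = H' (unif n)) {p : ℝ} (hp : 1 / 2 ≤ p) (hp1 : p ≤ 1) :
    H (binary p) = H' (binary p) := by
  have hrat : ∀ m r : ℕ, 2 ≤ m → 1 ≤ r → r ≤ m →
      H (binary (m / (m + r))) = H' (binary (m / (m + r))) := fun m r hm hr hrm => by
    have hle : (m : ℝ) / (m + r) ≤ 1 := by
      rw [div_le_one (by positivity)]; linarith [(Nat.cast_nonneg r : (0 : ℝ) ≤ r)]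
    have := mix_sub_eq h h' hH hH' hm (by positivity) hle (dist_unif (by omega))
      ((dist_unif hr).mono hrm) (hu m (by omega)) (hu r hr)
    rw [mix_unif (by omega) (by omega), hu (m + r) (by omega)] at this
    linarith
  -- Clamping to `[1/2, 1]` gives continuous functions on the whole line, so their coincidence set
  -- is closed.
  have hI : ∀ x : ℝ, max (1 / 2) (min x 1) ∈ Set.Icc (0 : ℝ) 1 := fun x =>
    ⟨le_trans (by norm_num) (le_max_left _ _), max_le (by norm_num) (min_le_right _ _)⟩
  have hc : Continuous fun x : ℝ => H (binary (max (1 / 2) (min x 1))) :=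
    h.continuousOn_binary.comp_continuous (by fun_prop) hI
  have hc' : Continuous fun x : ℝ => H' (binary (max (1 / 2) (min x 1))) :=
    h'.continuousOn_binary.comp_continuous (by fun_prop) hI
  have hcl := isClosed_eq hc hc'
  have hsub : Set.Ioo (1 / 2 : ℝ) 1 ∩ Set.range ((↑) : ℚ → ℝ) ⊆
      {x | H (binary (max (1 / 2) (min x 1))) = H' (binary (max (1 / 2) (min x 1)))} := by
    rintro _ ⟨⟨hx0, hx1⟩, c, rfl⟩
    have hd : (0 : ℝ) < c.den := by exact_mod_cast c.den_pos
    obtain ⟨k, hk⟩ : ∃ k : ℕ, c.num = k := Int.eq_ofNat_of_zero_le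
      (Rat.num_nonneg.2 (by exact_mod_cast (by linarith : (0 : ℝ) ≤ c)))
    have hck : (c : ℝ) = k / c.den := by
      rw [Rat.cast_def, hk]; simp
    have hk1 : k < c.den := by
      rw [hck, div_lt_one hd] at hx1; exact_mod_cast hx1
    have hk2 : c.den < 2 * k := by
      rw [hck, div_lt_div_iff₀ two_pos hd] at hx0
      have : ((c.den : ℕ) : ℝ) < ((2 * k : ℕ) : ℝ) := by push_cast; linarith
      exact_mod_cast this
    have hval : (c : ℝ) = k / (k + (c.den - k : ℕ)) := by
      rw [hck, Nat.cast_sub hk1.le]; simp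
    simp only [Set.mem_ofPred_eq]
    rw [min_eq_left hx1.le, max_eq_right hx0.le, hval]
    exact hrat k (c.den - k) (by omega) (by omega) (by omega)
  have hmem : p ∈ closure (Set.Ioo (1 / 2 : ℝ) 1 ∩ Set.range ((↑) : ℚ → ℝ)) := by
    have h1 := Rat.denseRange_cast (𝕜 := ℝ).open_subset_closure_inter
      (isOpen_Ioo (a := (1 / 2 : ℝ)) (b := 1))
    have h2 := closure_minimal h1 isClosed_closure
    rw [closure_Ioo (by norm_num)] at h2
    exact h2 ⟨hp, hp1⟩
  have := closure_minimal hsub hcl hmem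
  simp only [Set.mem_ofPred_eq] at this
  rwa [min_eq_left hp1, max_eq_right hp] at this

/-- Without symmetry, `p < 1/2` cannot be replaced by `1 - p`. Instead `(1/2, 0, p/2, (1-p)/2)` is
regrouped by `mix_regroup` using weights at least `1/2` only, so `H` and `H'` agree on it. Its first
grouping then yields `binary p` by injectivity of `F`. -/
lemma binary_eq (h : SeqAxioms 1 q H F) (h' : SeqAxioms 1 q H' F)
    (hH : (seqValues H).Nontrivial) (hH' : (seqValues H').Nontrivial)
    (hu : ∀ n, 1 ≤ n → H (unif n) = H' (unif n)) {p : ℝ} (hp0 : 0 ≤ p) (hp1 : p ≤ 1) :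
    H (binary p) = H' (binary p) := by
  have hδ := dist_unif (le_refl 1)
  have e1 := hu 1 le_rfl
  have hden : 0 < 1 / 2 + (1 - 1 / 2) * p := by linarith
  have hs1 : 1 / 2 / (1 / 2 + (1 - 1 / 2) * p) ≤ 1 := by
    rw [div_le_one hden]; linarith
  have hs2 : 1 / 2 ≤ 1 / 2 / (1 / 2 + (1 - 1 / 2) * p) := by
    rw [le_div_iff₀ hden]; linarith
  have hA := dist_mix_point (by linarith) hs1
  have eA := mix_sub_eq h h' hH hH' le_rfl (by linarith) hs1 (hδ.mono one_le_two)
    (hδ.mono one_le_two) e1 e1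
  rw [binary_eq_of_half_le h h' hH hH' hu hs2 hs1, sub_left_inj] at eA
  have eR := mix_sub_eq h h' hH hH' (by norm_num : 2 ≤ 3) hden.le (by linarith) hA
    (hδ.mono (by norm_num)) eA e1
  rw [binary_eq_of_half_le h h' hH hH' hu (by linarith) (by linarith), sub_left_inj,
    ← mix_regroup hden] at eR
  obtain ⟨y, hy, h2, h3⟩ := h.chain_mix (p := 1 / 2) le_rfl (by norm_num) (by norm_num)
    (hδ.mono one_le_two) (dist_binary hp0 hp1)
  obtain ⟨y', hy', h2', h3'⟩ := h'.chain_mix (p := 1 / 2) le_rfl (by norm_num) (by norm_num)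
    (hδ.mono one_le_two) (dist_binary hp0 hp1)
  have hyy : y = y' := by
    rw [h3, h3', binary_half, hu 2 one_le_two] at eR
    simpa [qAdd] using eR
  have hw : (0 : ℝ) < (1 - 1 / 2) ^ q := Real.rpow_pos_of_pos (by norm_num) q
  have hw' : (0 : ℝ) < (1 / 2) ^ q := Real.rpow_pos_of_pos (by norm_num) q
  rw [hyy, h2', e1, add_right_inj] at h2
  refine h.gen_invertible (mem_values (dist_binary hp0 hp1)) ?_
    (mul_left_cancel₀ (by positivity) h2).symm
  rw [h.seqValues_eq hH, ← h'.seqValues_eq hH']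
  exact mem_values (dist_binary hp0 hp1)

/-- An additive entropy is determined by its generator and its values at uniform distributions. -/
theorem unique (h : SeqAxioms 1 q H F) (h' : SeqAxioms 1 q H' F)
    (hH : (seqValues H).Nontrivial) (hH' : (seqValues H').Nontrivial)
    (hu : H (unif 2) = H' (unif 2)) {n : ℕ} {p : ℕ → ℝ} (hp : Dist n p) : H p = H' p := by
  have h0 := h.point_eq_zero hH
  have h0' := h'.point_eq_zero hH'
  have hun : ∀ n, 1 ≤ n → H (unif n) = H' (unif n) := fun n hn => by
    rcases hn.eq_or_lt with rfl | hn
    · rw [h0, h0']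
    · rw [h.unif_eq_log h0 hn, h'.unif_eq_log h0' hn, hu]
  have key : ∀ (k : ℕ) (p : ℕ → ℝ), Dist (2 ^ (k + 1)) p → H p = H' p := by
    intro k
    induction k with
    | zero =>
      intro p hp
      have hp2 : Dist 2 p := by simpa using hp
      have hsum := hp2.sum
      simp only [sum_range_succ, range_zero, sum_empty, zero_add] at hsum
      rw [eq_binary hp2]
      exact binary_eq h h' hH hH' hun (hp2.nonneg 0) (by linarith [hp2.nonneg 1])
    | succ k ih =>
      intro p hp
      have hk : 2 ≤ 2 ^ (k + 1) := by rw [pow_succ]; nlinarith [Nat.one_le_two_pow (n := k)]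
      rw [pow_succ, mul_comm] at hp
      obtain ⟨s, A, B, hs0, hs1, hA, hB, rfl⟩ := exists_eq_mix (by omega) hp
      have := mix_sub_eq h h' hH hH' hk hs0 hs1 hA hB (ih A hA) (ih B hB)
      rwa [binary_eq h h' hH hH' hun hs0 hs1, sub_left_inj] at this
  exact key n p (hp.mono (Nat.lt_two_pow_self.le.trans (Nat.pow_le_pow_right two_pos (by omega))))

end SeqAxioms

/-! ### The explicit entropies satisfy the axioms -/

section Entropy

variable {q τ : ℝ}

/-- Jensen's inequality with equal weights; maximality uses it for `-x ^ q`, `x log x` or `x ^ q`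
according to `q`. -/
lemma sum_uniform_le {φ : ℝ → ℝ} (hφ : ConvexOn ℝ (Set.Ici 0) φ) {n : ℕ} (hn : 2 ≤ n) (P : Δ n) :
    ∑ i, φ ((uniform n hn).1 i) ≤ ∑ i, φ (P.1 i) := by
  have hn0 : (0 : ℝ) < n := by positivity
  have := hφ.map_sum_le (t := univ) (w := fun _ : Fin n => 1 / (n : ℝ)) (p := P.1)
    (fun _ _ => by positivity) (by simp [hn0.ne']) (fun i _ => P.2.1 i)
  simp only [smul_eq_mul, ← mul_sum, P.2.2, mul_one] at this
  simp only [uniform, sum_const, card_univ, Fintype.card_fin, nsmul_eq_mul]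
  calc (n : ℝ) * φ (1 / n) ≤ n * (1 / n * ∑ i, φ (P.1 i)) := by gcongr
    _ = _ := by field_simp

lemma le_one_of_simplex {n : ℕ} (P : Δ n) (i : Fin n) : P.1 i ≤ 1 := by
  rw [← P.2.2]; exact single_le_sum (fun j _ => P.2.1 j) (mem_univ i)

lemma entropy_of_ne_one (hq1 : q ≠ 1) {n : ℕ} (P : Δ n) :
    entropy q τ P = 1 / (1 - q) * ((∑ k, P.1 k ^ q) ^ (-τ) - 1) := if_neg hq1

lemma entropy_one {n : ℕ} (P : Δ n) :
    entropy 1 τ P = τ * ∑ k, P.1 k * Real.logb 2 (P.1 k) := if_pos rfl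

lemma one_add_entropy (hq1 : q ≠ 1) {n : ℕ} (P : Δ n) :
    (1 - q) * entropy q τ P + 1 = (∑ k, P.1 k ^ q) ^ (-τ) := by
  have : 1 - q ≠ 0 := sub_ne_zero.2 hq1.symm
  rw [entropy_of_ne_one hq1]; field_simp; ring

/-- The generator undoes the outer power, so the chain rule becomes a statement about averages of
power sums. -/
lemma generator_entropy (hq1 : q ≠ 1) (hτ : τ < 0) {n : ℕ} (P : Δ n) :
    generator q τ (entropy q τ P) = ∑ k, P.1 k ^ q := by
  rw [generator, if_neg hq1, one_add_entropy hq1, ← Real.rpow_mul (sum_rpow_pos P).le,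
    show -τ * (-1 / τ) = 1 by field_simp [hτ.ne], Real.rpow_one]

lemma entropy_nonneg (hq : 0 < q) (hτ : τ < 0) {n : ℕ} (P : Δ n) : 0 ≤ entropy q τ P := by
  rcases lt_trichotomy q 1 with hq1 | rfl | hq1
  · have hN : 1 ≤ ∑ k, P.1 k ^ q := by
      rw [← P.2.2]
      refine sum_le_sum fun i _ => ?_
      simpa using Real.rpow_le_rpow_of_exponent_ge' (P.2.1 i) (le_one_of_simplex P i) hq.le hq1.le
    rw [entropy_of_ne_one hq1.ne]
    exact mul_nonneg (one_div_nonneg.2 (by linarith))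
      (sub_nonneg.2 (Real.one_le_rpow hN (by linarith)))
  · rw [entropy_one]
    refine mul_nonneg_of_nonpos_of_nonpos hτ.le (sum_nonpos fun i _ => ?_)
    exact mul_nonpos_of_nonneg_of_nonpos (P.2.1 i)
      (Real.logb_nonpos one_lt_two (P.2.1 i) (le_one_of_simplex P i))
  · have hN : ∑ k, P.1 k ^ q ≤ 1 := by
      rw [← P.2.2]
      refine sum_le_sum fun i _ => ?_
      simpa using Real.rpow_le_rpow_of_exponent_ge' (P.2.1 i) (le_one_of_simplex P i) zero_le_one
        hq1.le
    rw [entropy_of_ne_one hq1.ne']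
    exact mul_nonneg_of_nonpos_of_nonpos (one_div_nonpos.2 (by linarith))
      (sub_nonpos.2 (Real.rpow_le_one (sum_rpow_pos P).le hN (by linarith)))

lemma continuous_entropy (hq : 0 < q) {n : ℕ} : Continuous fun P : Δ n => entropy q τ P := by
  rcases eq_or_ne q 1 with rfl | hq1
  · simp only [entropy_one]
    refine continuous_const.mul (continuous_finsetSum _ fun i _ => ?_)
    have : (fun P : Δ n => P.1 i * Real.logb 2 (P.1 i)) =
        fun P => P.1 i * Real.log (P.1 i) / Real.log 2 := by
      funext P; rw [Real.logb]; ring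
    rw [this]
    exact (Real.continuous_mul_log.comp
      ((continuous_apply i).comp continuous_subtype_val)).div_const _
  · simp only [entropy_of_ne_one hq1]
    refine continuous_const.mul (Continuous.sub ?_ continuous_const)
    refine Continuous.rpow_const ?_ fun P => Or.inl (sum_rpow_pos P).ne'
    refine continuous_finsetSum _ fun i _ => ?_
    exact Continuous.rpow_const ((continuous_apply i).comp continuous_subtype_val)
      fun P => Or.inr hq.le

lemma entropy_le_uniform (hq : 0 < q) (hτ : τ < 0) {n : ℕ} (hn : 2 ≤ n) (P : Δ n) :
    entropy q τ P ≤ entropy q τ (uniform n hn) := by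
  rcases lt_trichotomy q 1 with hq1 | rfl | hq1
  · have hN := sum_uniform_le (Real.concaveOn_rpow hq.le hq1.le).neg hn P
    simp only [Pi.neg_apply, sum_neg_distrib, neg_le_neg_iff] at hN
    rw [entropy_of_ne_one hq1.ne, entropy_of_ne_one hq1.ne]
    exact mul_le_mul_of_nonneg_left (sub_le_sub_right
      (Real.rpow_le_rpow (sum_rpow_pos P).le hN (by linarith)) 1) (one_div_nonneg.2 (by linarith))
  · have hN := sum_uniform_le Real.convexOn_mul_log hn P
    rw [entropy_one, entropy_one]
    refine mul_le_mul_of_nonpos_left ?_ hτ.le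
    simp only [Real.logb, ← mul_div_assoc, ← sum_div]
    exact div_le_div_of_nonneg_right hN (Real.log_pos one_lt_two).le
  · have hN := sum_uniform_le (convexOn_rpow hq1.le) hn P
    rw [entropy_of_ne_one hq1.ne', entropy_of_ne_one hq1.ne']
    exact mul_le_mul_of_nonpos_left (sub_le_sub_right
      (Real.rpow_le_rpow (sum_rpow_pos _).le hN (by linarith)) 1)
      (one_div_nonpos.2 (by linarith))

lemma entropy_expand (hq : 0 < q) {n : ℕ} (P : Δ n) :
    entropy q τ (expand P) = entropy q τ P := by
  simp [entropy, expand, Fin.sum_univ_castSucc, Real.zero_rpow hq.ne']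

lemma sum_fin_mul {n m : ℕ} (g : Fin (n * m) → ℝ) :
    ∑ k, g k = ∑ i, ∑ j, g (finProdFinEquiv (i, j)) := by
  rw [← finProdFinEquiv.sum_comp, Fintype.sum_prod_type]

lemma escort_one {n : ℕ} (P : Δ n) (i : Fin n) : escort 1 P i = P.1 i := by
  simp only [escort, Real.rpow_one]
  rw [P.2.2, div_one]

/-- The entropy with parameters `q` and `τ` satisfies the axioms. -/
theorem axioms_of_entropy (hq : 0 < q) (hτ : τ < 0) {D : (n : ℕ) → Δ n → ℝ}
    (hD : ∀ n, 2 ≤ n → ∀ P : Δ n, D n P = entropy q τ P) {f : ℝ → ℝ} {a b : ℝ} (ha : a ≠ 0)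
    (hf : ∀ x ∈ values D, f x = a * generator q τ x + b) : Axioms q D f := by
  have hexp : ∀ n, 2 ≤ n → ∀ P : Δ n, D (n + 1) (expand P) = D n P := fun n hn P => by
    rw [hD n hn, hD (n + 1) (by omega), entropy_expand hq]
  have hcont : ∀ n, 2 ≤ n → Continuous (D n) := fun n hn => by
    rw [show D n = fun P => entropy q τ P from funext (hD n hn)]
    exact continuous_entropy hq
  have hgen : ContinuousOn (generator q τ) (values D) := by
    rcases eq_or_ne q 1 with rfl | hq1
    · have : generator 1 τ = fun x => τ * x := funext fun x => if_pos rfl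
      rw [this]; fun_prop
    · have : generator q τ = fun x => ((1 - q) * x + 1) ^ (-1 / τ) := funext fun x => if_neg hq1
      rw [this]
      refine ContinuousOn.rpow_const (by fun_prop) ?_
      rintro _ ⟨n, hn, P, rfl⟩
      left
      rw [hD n hn, one_add_entropy hq1]
      exact (Real.rpow_pos_of_pos (sum_rpow_pos P) _).ne'
  have hfc : ContinuousOn f (values D) := ((hgen.const_smul a).add continuousOn_const).congr
    fun x hx => by simpa using hf x hx
  refine ⟨fun n hn P => ?_, hcont, fun n hn P => ?_, hexp, hfc, ?_, ?_⟩
  · rw [hD n hn]; exact entropy_nonneg hq hτ P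
  · rw [hD n hn, hD n hn]; exact entropy_le_uniform hq hτ hn P
  · intro x hx y hy hxy
    rw [hf x hx, hf y hy] at hxy
    replace hxy : generator q τ x = generator q τ y := mul_left_cancel₀ ha (by linarith)
    obtain ⟨n, hn, P, rfl⟩ := hx
    obtain ⟨n', hn', P', rfl⟩ := hy
    rw [hD n hn, hD n' hn'] at hxy ⊢
    rcases eq_or_ne q 1 with rfl | hq1
    · simp only [generator, if_true] at hxy
      exact mul_left_cancel₀ hτ.ne hxy
    · rw [generator_entropy hq1 hτ, generator_entropy hq1 hτ] at hxy
      rw [entropy_of_ne_one hq1, entropy_of_ne_one hq1, hxy]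
  · intro n m hn hm R P Q hP hQ
    have hR : ∀ i j, R.1 (finProdFinEquiv (i, j)) = P.1 i * (Q i).1 j := fun i j => by
      by_cases hi : P.1 i = 0
      · have := hP i
        rw [hi] at this
        rw [hi, zero_mul]
        exact (sum_eq_zero_iff_of_nonneg fun j _ => R.2.1 _).1 this.symm j (mem_univ j)
      · rw [hQ i hi j, mul_div_cancel₀ _ hi]
    -- The conditional entropy is itself a value `D k T`, so for `q ≠ 1` its generator is again a
    -- power sum.
    obtain ⟨⟨k, hk, T, hT⟩, h2⟩ := condEntropy_spec (q := q) hexp hcont hfc hm P Q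
    have hmem : ∀ i, D m (Q i) ∈ values D := fun i => ⟨m, hm, Q i, rfl⟩
    rw [hf _ ⟨k, hk, T, hT⟩] at h2
    simp only [hf _ (hmem _), mul_add, sum_add_distrib] at h2
    rw [← sum_mul, sum_escort, one_mul, add_left_inj] at h2
    replace h2 : generator q τ (condEntropy q D f P Q) =
        ∑ i, escort q P i * generator q τ (D m (Q i)) := by
      refine mul_left_cancel₀ ha (h2.trans ?_)
      rw [mul_sum]
      exact sum_congr rfl fun i _ => by ring
    have hnm : 2 ≤ n * m := by nlinarith
    rw [hD n hn, hD _ hnm]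
    simp only [hD m hm] at h2
    rcases eq_or_ne q 1 with rfl | hq1
    · simp only [generator, if_true, escort_one, entropy_one] at h2
      have h3 : condEntropy 1 D f P Q =
          ∑ i, P.1 i * (τ * ∑ j, (Q i).1 j * Real.logb 2 ((Q i).1 j)) := by
        refine mul_left_cancel₀ hτ.ne (h2.trans ?_)
        rw [mul_sum]
        exact sum_congr rfl fun i _ => by ring
      rw [h3, qAdd, sub_self, zero_mul, zero_mul, add_zero, entropy_one, entropy_one, sum_fin_mul,
        mul_sum, mul_sum, ← sum_add_distrib]
      refine sum_congr rfl fun i _ => ?_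
      simp only [hR]
      by_cases hi : P.1 i = 0
      · simp [hi]
      have h4 : ∀ j, P.1 i * (Q i).1 j * Real.logb 2 (P.1 i * (Q i).1 j) =
          P.1 i * Real.logb 2 (P.1 i) * (Q i).1 j +
            P.1 i * ((Q i).1 j * Real.logb 2 ((Q i).1 j)) := fun j => by
        by_cases hj : (Q i).1 j = 0
        · simp [hj]
        · rw [Real.logb_mul hi hj]; ring
      rw [sum_congr rfl fun j _ => h4 j, sum_add_distrib, ← mul_sum, ← mul_sum, (Q i).2.2]
      ring
    · simp only [generator_entropy hq1 hτ] at h2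
      rw [← hT, hD k hk] at h2 ⊢
      rw [generator_entropy hq1 hτ] at h2
      -- The escort denominator cancels, so power sums multiply; so do the quantities `1 + (1 - q)
      -- D`, which is `⊕_q`-additivity.
      have h3 : ∑ l, R.1 l ^ q = (∑ i, P.1 i ^ q) * ∑ l, T.1 l ^ q := by
        rw [h2, sum_fin_mul, mul_sum]
        refine sum_congr rfl fun i _ => ?_
        have hne := (sum_rpow_pos (q := q) P).ne'
        rw [escort, ← mul_assoc, mul_div_cancel₀ _ hne, mul_sum]
        exact sum_congr rfl fun j _ => by rw [hR, Real.mul_rpow (P.2.1 i) ((Q i).2.1 j)]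
      have h4 := one_add_entropy (τ := τ) hq1 R
      rw [h3, Real.mul_rpow (sum_rpow_pos P).le (sum_rpow_pos T).le, ← one_add_entropy hq1,
        ← one_add_entropy hq1] at h4
      refine mul_left_cancel₀ (sub_ne_zero.2 hq1.symm) ?_
      rw [qAdd]; linear_combination h4

lemma entropy_uniform {n : ℕ} (hn : 2 ≤ n) : entropy q τ (uniform n hn) =
    if q = 1 then -τ * Real.logb 2 n else 1 / (1 - q) * (((n : ℝ) ^ (1 - q)) ^ (-τ) - 1) := by
  have hn0 : (0 : ℝ) < n := by positivity
  unfold entropy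
  simp only [uniform, sum_const, card_univ, Fintype.card_fin, nsmul_eq_mul]
  split_ifs with hq1
  · rw [one_div, Real.logb_inv]; field_simp
  · rw [one_div (n : ℝ), Real.inv_rpow hn0.le, ← Real.rpow_neg hn0.le, sub_eq_add_neg,
      Real.rpow_add hn0, Real.rpow_one]

end Entropy

/-! ### Identification of the entropy and its generator -/

section Main

variable {q τ : ℝ} {D : (n : ℕ) → Δ n → ℝ} {f : ℝ → ℝ}

/-- This is injective in `τ`: it serves both to choose `τ` and to recover it. -/
lemma qLog_entropy_uniform_two :
    qLog q (entropy q τ (uniform 2 le_rfl)) = if q = 1 then -τ else -τ * Real.log 2 := by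
  rw [entropy_uniform]
  by_cases hq1 : q = 1
  · simp [qLog, hq1]
  · have h1 : 1 - q ≠ 0 := sub_ne_zero.2 (Ne.symm hq1)
    simp only [qLog, hq1, if_false, Nat.cast_ofNat]
    rw [show 1 + (1 - q) * (1 / (1 - q) * (((2 : ℝ) ^ (1 - q)) ^ (-τ) - 1)) =
      ((2 : ℝ) ^ (1 - q)) ^ (-τ) by field_simp; ring, Real.log_rpow (by positivity),
      Real.log_rpow two_pos]
    field_simp

lemma nonconstant_of_entropy (hq : 0 < q) (hτ : τ < 0)
    (hD : ∀ n, 2 ≤ n → ∀ P : Δ n, D n P = entropy q τ P) : Nonconstant D := by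
  refine ⟨2, le_rfl, uniform 2 le_rfl, restrict ((dist_unif le_rfl).mono one_le_two), ?_⟩
  have h0 : entropy q τ (restrict ((dist_unif le_rfl).mono one_le_two)) = 0 := by
    simp [entropy, restrict, unif, Real.zero_rpow hq.ne']
  rw [hD 2 le_rfl, hD 2 le_rfl, h0]
  intro h
  have := qLog_entropy_uniform_two (q := q) (τ := τ)
  rw [h, qLog_zero] at this
  have hlog := Real.log_pos one_lt_two
  split_ifs at this
  · linarith
  · nlinarith

lemma seqValues_nontrivial (hD : ∀ n, 2 ≤ n → ∀ P : Δ n, D (n + 1) (expand P) = D n P)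
    (hc : Nonconstant D) : (seqValues (seqOf D)).Nontrivial := by
  rw [seqValues_seqOf hD]
  obtain ⟨n, hn, P, P', h⟩ := hc
  exact ⟨_, ⟨n, hn, P, rfl⟩, _, ⟨n, hn, P', rfl⟩, h⟩

lemma SeqAxioms.qLog_nontrivial {D : (ℕ → ℝ) → ℝ} (h : SeqAxioms q q D f)
    (hD : (seqValues D).Nontrivial) : (seqValues fun p => qLog q (D p)).Nontrivial := by
  have hD' := hD
  obtain ⟨_, ⟨n, p, hp, rfl⟩, _, ⟨n', p', hp', rfl⟩, hne⟩ := hD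
  refine ⟨_, ⟨n, p, hp, rfl⟩, _, ⟨n', p', hp', rfl⟩, fun he => hne ?_⟩
  rw [← qExp_qLog (h.one_add_pos hD' (SeqAxioms.mem_values hp)),
    ← qExp_qLog (h.one_add_pos hD' (SeqAxioms.mem_values hp'))]
  exact congrArg (qExp q) he

/-- The generator of a non-constant entropy, in terms of its value at the uniform distribution. -/
lemma exists_generator (hq : 0 < q) (h : Axioms q D f) (hc : Nonconstant D) :
    ∃ τ < 0, qLog q (entropy q τ (uniform 2 le_rfl)) = qLog q (seqOf D (unif 2)) ∧
      ∃ a b : ℝ, a ≠ 0 ∧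
        ∀ x, 0 ≤ x → 0 < 1 + (1 - q) * x → f x = a * generator q τ x + b := by
  have hS := h.seqAxioms
  have hn := seqValues_nontrivial h.expandable hc
  have hL := hS.qLog_comp hn
  have hn' := hS.qLog_nontrivial hn
  have hpos := hL.unif_two_pos hn'
  have hJ := hL.seqValues_eq hn'
  have hlog := Real.log_pos one_lt_two
  have hf : ∀ x, 0 < 1 + (1 - q) * x → f x = f (qExp q (qLog q x)) := fun x hx => by
    rw [qExp_qLog hx]
  have hnn : ∀ x, 0 ≤ x → 0 < 1 + (1 - q) * x → 0 ≤ qLog q x := fun x hx hx' => by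
    rw [← qLog_zero (q := q)]
    exact qLog_mono (by simp) hx' hx
  obtain ⟨a, b, ha, hlin | ⟨l, hl, hexp⟩⟩ := generator_of_translate
    (hJ ▸ hL.gen_continuous) (hJ ▸ hL.gen_invertible)
    (fun x y z t w hx hy hz ht hw0 hw1 he => hL.translate hq hn' hx hy hz ht hw0 hw1 he)
  · obtain rfl := hL.eq_one_of_affine hn' ha hlin
    set c := qLog 1 (seqOf D (unif 2))
    refine ⟨-c, neg_neg_of_pos hpos, ?_, a / -c, b,
      div_ne_zero ha (neg_ne_zero.2 hpos.ne'), fun x hx hx' => ?_⟩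
    · rw [qLog_entropy_uniform_two, if_pos rfl, neg_neg]
    · have hc0 : c ≠ 0 := hpos.ne'
      rw [hf x hx', hlin _ (hnn x hx hx')]
      simp only [qLog, generator, if_true]
      field_simp
  · have he := hL.exponent_eq hn' ha hl hexp
    set u := qLog q (seqOf D (unif 2))
    have hu : 0 < u / Real.log 2 := div_pos hpos hlog
    have h1q : 1 - q ≠ 0 := by rw [← he]; exact mul_ne_zero hl hu.ne'
    have hq1 : q ≠ 1 := fun hq1 => h1q (by rw [hq1, sub_self])
    -- Matching at `U_2` gives `τ`; then `l u / log 2 = 1 - q` says that `l / (1 - q) = -1 / τ`, the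
    -- exponent in `generator`.
    refine ⟨-(u / Real.log 2), neg_neg_of_pos hu, ?_, a, b, ha, fun x hx hx' => ?_⟩
    · rw [qLog_entropy_uniform_two, if_neg hq1]; field_simp
    · rw [hf x hx', hexp _ (hnn x hx hx'), generator, if_neg hq1, add_comm ((1 - q) * x),
        Real.rpow_def_of_pos hx', qLog, if_neg hq1]
      congr 3
      rw [← he]
      have := hpos.ne'
      field_simp

theorem classification (hq : 0 < q) (h : Axioms q D f) (hc : Nonconstant D) :
    ∃ τ < 0, (∀ n, 2 ≤ n → ∀ P : Δ n, D n P = entropy q τ P) ∧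
      ∃ a b : ℝ, a ≠ 0 ∧ ∀ x ∈ values D, f x = a * generator q τ x + b := by
  obtain ⟨τ, hτ, hu, a, b, ha, hf⟩ := exists_generator hq h hc
  have hS := h.seqAxioms
  have hn := seqValues_nontrivial h.expandable hc
  let D' : (n : ℕ) → Δ n → ℝ := fun n P => entropy q τ P
  have hD' : ∀ n, 2 ≤ n → ∀ P : Δ n, D' n P = entropy q τ P := fun _ _ _ => rfl
  -- The formula for `f` holds for every `x ≥ 0` with `1 + (1 - q) x > 0`, hence on the values of
  -- `D'` before these are known to be those of `D`.
  have h' : Axioms q D' f := by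
    refine axioms_of_entropy (b := b) hq hτ hD' ha ?_
    rintro _ ⟨n, hn, P, rfl⟩
    refine hf _ (entropy_nonneg hq hτ P) ?_
    rcases eq_or_ne q 1 with rfl | hq1
    · simp
    · rw [add_comm, one_add_entropy hq1]
      exact Real.rpow_pos_of_pos (sum_rpow_pos P) _
  have hS' := h'.seqAxioms
  have hn' := seqValues_nontrivial h'.expandable (nonconstant_of_entropy hq hτ hD')
  have hu' : qLog q (seqOf D (unif 2)) = qLog q (seqOf D' (unif 2)) := by
    rw [← hu, seqOf_eq h'.expandable le_rfl (dist_unif one_le_two), hD' 2 le_rfl,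
      restrict_unif le_rfl]
  refine ⟨τ, hτ, fun n hn2 P => ?_, a, b, ha, fun x hx => ?_⟩
  · have hP := dist_extend P
    have key := (hS.qLog_comp hn).unique (hS'.qLog_comp hn') (hS.qLog_nontrivial hn)
      (hS'.qLog_nontrivial hn') hu' hP
    rw [← hD' n hn2, ← seqOf_extend h.expandable hn2, ← seqOf_extend h'.expandable hn2,
      ← qExp_qLog (hS.one_add_pos hn (SeqAxioms.mem_values hP)),
      ← qExp_qLog (hS'.one_add_pos hn' (SeqAxioms.mem_values hP))]
    exact congrArg (qExp q) key
  · refine hf x ?_ (hS.one_add_pos hn (seqValues_seqOf h.expandable ▸ hx))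
    obtain ⟨n, hn2, P, rfl⟩ := hx
    exact h.nonneg n hn2 P

end Main

end GSK

theorem theorem2 (q : ℝ) (hq : 0 < q) (D : (n : ℕ) → GSK.Δ n → ℝ) :
    (((∃ f : ℝ → ℝ, GSK.Axioms q D f) ∧ GSK.Nonconstant D) ↔
      ∃ τ : ℝ, τ < 0 ∧ ∀ n : ℕ, 2 ≤ n → ∀ P : GSK.Δ n, D n P = GSK.entropy q τ P) ∧
    (∀ τ : ℝ, τ < 0 → (∀ n : ℕ, 2 ≤ n → ∀ P : GSK.Δ n, D n P = GSK.entropy q τ P) →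
      ∀ f : ℝ → ℝ, GSK.Axioms q D f ↔
        ∃ a b : ℝ, a ≠ 0 ∧ ∀ x ∈ GSK.values D, f x = a * GSK.generator q τ x + b) := by
  refine ⟨⟨?_, ?_⟩, fun τ hτ hD f => ⟨fun h => ?_, ?_⟩⟩
  · rintro ⟨⟨f, h⟩, hc⟩
    obtain ⟨τ, hτ, hD, -⟩ := GSK.classification hq h hc
    exact ⟨τ, hτ, hD⟩
  · rintro ⟨τ, hτ, hD⟩
    exact ⟨⟨GSK.generator q τ, GSK.axioms_of_entropy hq hτ hD one_ne_zero (b := 0)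
      fun x _ => by ring⟩, GSK.nonconstant_of_entropy hq hτ hD⟩
  · obtain ⟨τ', hτ', hD', hf⟩ :=
      GSK.classification hq h (GSK.nonconstant_of_entropy hq hτ hD)
    have he := congrArg (GSK.qLog q)
      ((hD 2 le_rfl (GSK.uniform 2 le_rfl)).symm.trans (hD' 2 le_rfl (GSK.uniform 2 le_rfl)))
    rw [GSK.qLog_entropy_uniform_two, GSK.qLog_entropy_uniform_two] at he
    obtain rfl : τ = τ' := by
      split_ifs at he
      · linarith
      · exact neg_injective (mul_right_cancel₀ (Real.log_pos one_lt_two).ne' he)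
    exact hf
  · rintro ⟨a, b, ha, hf⟩
    exact GSK.axioms_of_entropy hq hτ hD ha hf
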